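/- Identify the Cantor space $2^\omega$ with the set of all oracles $A\subseteq\{0,1\}^{*}$ through characteristic functions, using the enumeration of binary strings by length and lexicographically within each length. For an oracle $A$, let $\mathbf{P}^A$ (respectively $\mathbf{NP}^A$) be the class of languages over $\{0,1\}$ accepted by deterministic (respectively nondeterministic) Turing machines with oracle $A$ that run in polynomial time, i.e. for which there is a $d$ such that on inputs of length $n$ every computation path halts within $n^d+d$ steps; let $\mathbf{co\text{-}NP}^A$ be the class of complements of languages in $\mathbf{NP}^A$. Put $$\mathbf{O}=\{A : \mathbf{P}^A\neq \mathbf{NP}^A\},\qquad \mathbf{O'}=\{A : \mathbf{NP}^A\neq \mathbf{co\text{-}NP}^A\}.$$ A set $S\subseteq 2^\omega$ is lightface $\Pi^0_2$ if there is a recursively enumerable set $W\subseteq\omega\times 2^{<\omega}$ such that $f\in S$ if and only if for every $n$ there is an $m$ with $(n, f{\restriction} m)\in W$. Theorem. Both $\mathbf{O}$ and $\mathbf{O'}$ are lightface $\Pi^0_2$, and hence both are Borel subsets of $2^\omega$. Moreover, there are a single nondeterministic oracle Turing machine $U$ and a single number $d$ such that, for every oracle $A$, every computation path of $U^A$ on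 inputs of length $n$ halts within $n^d+d$ steps, and $L(U^A)\in\mathbf{P}^A$ if and only if $\mathbf{P}^A=\mathbf{NP}^A$. -/

import Mathlib

namespace RelComplexity

/-- What a machine with work tapes `0, …, k` and state set `Q` does in one ordinary step: the next
state; on every work tape the symbol written (`none` is the blank) and the head movement (`none`
means that the head stays); and possibly a bit appended to the string on the query tape. -/
structure Action (Q : Type) (k : ℕ) where
  next : Q
  write : Fin (k + 1) → Option Bool
  move : Fin (k + 1) → Option Turing.Dir
  ask : Option Bool

/-- A nondeterministic oracle Turing machine over the tape alphabet `{0, 1, blank}`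
(`Option Bool`), with finitely many states, finitely many two-way infinite work tapes, the first of
which initially holds the input, and a write-only query tape. -/
structure OracleNTM where
  Q : Type
  finite : Finite Q
  /-- there are `k + 1` work tapes -/
  k : ℕ
  start : Q
  accept : Q
  /-- in state `query` the oracle is asked for the string on the query tape; the query tape is
  erased and the next state is `yes` or `no`, according to the answer -/
  query : Q
  yes : Q
  no : Q
  /-- the transitions that are possible in a given state with given scanned symbols -/
  δ : Q → (Fin (k + 1) → Option Bool) → Set (Action Q k)

namespace OracleNTM

variable (M : OracleNTM)

/-- Configurations: the state, the work tapes with their heads, the string on the query tape. -/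
structure Cfg where
  state : M.Q
  tape : Fin (M.k + 1) → Turing.Tape (Option Bool)
  queryTape : List Bool

/-- Start configuration: the input on work tape `0`, scanned at its first symbol; all other tapes
are blank. -/
def init (x : List Bool) : M.Cfg where
  state := M.start
  tape i := if i = 0 then Turing.Tape.mk₁ (x.map some) else Turing.Tape.mk₁ []
  queryTape := []

/-- The configuration that results from carrying out an action. -/
def act (c : M.Cfg) (a : Action M.Q M.k) : M.Cfg where
  state := a.next
  tape i := match a.move i with
    | none => (c.tape i).write (a.write i)
    | some d => ((c.tape i).write (a.write i)).move d
  queryTape := c.queryTape ++ a.ask.toList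

open Classical in
/-- The configuration that results from asking the oracle `A`. -/
noncomputable def answer (A : Set (List Bool)) (c : M.Cfg) : M.Cfg where
  state := if c.queryTape ∈ A then M.yes else M.no
  tape := c.tape
  queryTape := []

/-- `M.Step A c c'`: with oracle `A`, the machine can pass from `c` to `c'` in one step. -/
def Step (A : Set (List Bool)) (c c' : M.Cfg) : Prop :=
  (c.state = M.query ∧ c' = M.answer A c) ∨
    (c.state ≠ M.query ∧ ∃ a ∈ M.δ c.state (fun i => (c.tape i).head), c' = M.act c a)

/-- The configurations that can be reached on input `x` in exactly `n` steps. -/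
def cfgsAfter (A : Set (List Bool)) (x : List Bool) : ℕ → Set M.Cfg
  | 0 => {M.init x}
  | n + 1 => {c' | ∃ c ∈ cfgsAfter A x n, M.Step A c c'}

/-- Some computation path on input `x` halts (no further step is possible) in the accepting
state. -/
def Accepts (A : Set (List Bool)) (x : List Bool) : Prop :=
  ∃ n, ∃ c ∈ M.cfgsAfter A x n, (∀ c', ¬ M.Step A c c') ∧ c.state = M.accept

/-- The language `L(M^A)`. -/
def language (A : Set (List Bool)) : Set (List Bool) := {x | M.Accepts A x}

/-- Every computation path on input `x` halts after at most `t` steps. -/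
def HaltsWithin (A : Set (List Bool)) (x : List Bool) (t : ℕ) : Prop :=
  M.cfgsAfter A x (t + 1) = ∅

/-- `M^A` runs in polynomial time, with time bound `n ^ d + d` on inputs of length `n`. -/
def PolyTime (A : Set (List Bool)) (d : ℕ) : Prop :=
  ∀ x : List Bool, M.HaltsWithin A x (x.length ^ d + d)

/-- At most one transition is possible in each situation. -/
def Deterministic : Prop := ∀ q s, (M.δ q s).Subsingleton

end OracleNTM

/-- The class `P^A`. -/
def P (A : Set (List Bool)) : Set (Set (List Bool)) :=
  {L | ∃ M : OracleNTM, M.Deterministic ∧ (∃ d, M.PolyTime A d) ∧ M.language A = L}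

/-- The class `NP^A`. -/
def NP (A : Set (List Bool)) : Set (Set (List Bool)) :=
  {L | ∃ M : OracleNTM, (∃ d, M.PolyTime A d) ∧ M.language A = L}

/-- The class `co-NP^A`. -/
def coNP (A : Set (List Bool)) : Set (Set (List Bool)) := {L | Lᶜ ∈ NP A}

/-- The position of a binary string in the enumeration of all binary strings by length, and
lexicographically within each length: `ε, 0, 1, 00, 01, 10, 11, 000, …`. -/
def strIndex (w : List Bool) : ℕ := w.foldl (fun n b => 2 * n + 1 + b.toNat) 0

theorem strIndex_append_singleton (w : List Bool) (b : Bool) :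
    strIndex (w ++ [b]) = 2 * strIndex w + 1 + b.toNat := by
  simp [strIndex]

theorem strIndex_bijective : Function.Bijective strIndex := by
  constructor
  · intro v
    induction v using List.reverseRecOn with
    | nil =>
      intro w h
      induction w using List.reverseRecOn with
      | nil => rfl
      | append_singleton w c _ =>
        rw [strIndex_append_singleton] at h
        simp only [strIndex, List.foldl_nil] at h
        omega
    | append_singleton v b ih =>
      intro w h
      induction w using List.reverseRecOn with
      | nil =>
        rw [strIndex_append_singleton] at h
        simp only [strIndex, List.foldl_nil] at h
        omega
      | append_singleton w c _ =>
        rw [strIndex_append_singleton, strIndex_append_singleton] at h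
        have h1 : strIndex v = strIndex w ∧ b = c := by
          cases b <;> cases c <;> simp at h ⊢ <;> omega
        rw [ih h1.1, h1.2]
  · intro n
    induction n using Nat.strong_induction_on with
    | _ n ih =>
      rcases Nat.eq_zero_or_pos n with h0 | h0
      · exact ⟨[], by simp [strIndex, h0]⟩
      · obtain ⟨w, hw⟩ := ih ((n - 1) / 2) (by omega)
        refine ⟨w ++ [decide ((n - 1) % 2 = 1)], ?_⟩
        rw [strIndex_append_singleton, hw]
        rcases Nat.mod_two_eq_zero_or_one (n - 1) with h | h <;> simp [h] <;> omega

/-- The oracle with characteristic sequence `f` with respect to the above enumeration of strings;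
this identifies the Cantor space with the set of all oracles. -/
def oracle (f : ℕ → Bool) : Set (List Bool) := {w | f (strIndex w) = true}

theorem oracle_bijective : Function.Bijective oracle := by
  classical
  constructor
  · intro f g h
    funext n
    obtain ⟨w, rfl⟩ := strIndex_bijective.2 n
    have h1 : w ∈ oracle f ↔ w ∈ oracle g := by rw [h]
    exact Bool.eq_iff_iff.2 h1
  · intro A
    refine ⟨fun n => decide ((Equiv.ofBijective _ strIndex_bijective).symm n ∈ A), ?_⟩
    ext w
    simp [oracle]

/-- `R ⊆ ℕ × 2^ω` is lightface `Σ⁰₁` (semirecursive): there is a recursively enumerable set `W` of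
pairs `(n, σ)` such that `R n f` holds if and only if `W (n, σ)` for some finite initial segment
`σ = (f 0, …, f (m - 1))` of `f`. -/
def LightfaceSigma01 (R : ℕ → (ℕ → Bool) → Prop) : Prop :=
  ∃ W : ℕ × List Bool → Prop, REPred W ∧ ∀ n f, R n f ↔ ∃ m, W (n, (List.range m).map f)

/-- `S ⊆ 2^ω` is lightface `Π⁰₂`: it is of the form `{f | ∀ n, R n f}` with `R` lightface `Σ⁰₁`. -/
def LightfacePi02 (S : Set (ℕ → Bool)) : Prop :=
  ∃ R : ℕ → (ℕ → Bool) → Prop, LightfaceSigma01 R ∧ S = {f | ∀ n, R n f}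

/-- The set `O` of oracles `A` with `P^A ≠ NP^A`, as a subset of the Cantor space. -/
def sepPNP : Set (ℕ → Bool) := {f | P (oracle f) ≠ NP (oracle f)}

/-- The set `O'` of oracles `A` with `NP^A ≠ co-NP^A`, as a subset of the Cantor space. -/
def sepNPcoNP : Set (ℕ → Bool) := {f | NP (oracle f) ≠ coNP (oracle f)}

end RelComplexity

/-! Everything rests on one problem that is complete for NP^A uniformly in A. The machine
`evaluator` runs a nondeterministic straight-line program coded by its input; it never moves back on
the input tape, so it halts in linear time for every oracle (`evaluator_polyTime`).

Completeness: an accepting path of a machine is described by a list of rules, each of which fixes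
the scanned symbol, the written symbol and the head movement on every tape. Once this list is
guessed the tapes no longer interact, so a program with a single work tape can check them one after
another, undoing its changes in between. States become additional tapes with one symbol each, and
oracle questions are asked while the rules are guessed (`exists_pieces`). The program consists of a
bounded number of pieces: fixed ones, ones repeated polynomially often, and ones spelled out by the
input. Nested loops over unary counters therefore write its code in polynomial time without the
oracle, and a machine can be run on the result (`exists_compMachine`). Hence P^A = NP^A if and only
if the language of the evaluator is in P^A, and NP^A = co-NP^A if and only if its complement is in
NP^A (`evaluator_mem_P_iff`, `evaluator_compl_mem_NP_iff`).

Complexity of the two sets: non-membership says that for every machine and time exponent there is an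
input on which the machine overruns its bound or gives the wrong answer. Within a time bound only
finitely many strings can be asked about (`OracleNTM.after_congr`), so such a failure is witnessed
by an initial segment of A, and a simulation on lists recognises witnesses primitive recursively
(`primrec_refutes`). This is the required "for all, exists" form (`lightfacePi02_not_exists`), and
it exhibits the sets as countable intersections of open sets. -/

namespace RelComplexity
open Turing

/-! ### Computations from an arbitrary configuration -/

namespace OracleNTM

/-- The configurations that can be reached from `c` in exactly `n` steps. -/
def after (M : OracleNTM) (A : Set (List Bool)) (c : M.Cfg) : ℕ → Set M.Cfg
  | 0 => {c}
  | n + 1 => {c' | ∃ d ∈ M.after A c n, M.Step A d c'}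

/-- Some computation path from `c` halts in the accepting state. -/
def AcceptsFrom (M : OracleNTM) (A : Set (List Bool)) (c : M.Cfg) : Prop :=
  ∃ n, ∃ c' ∈ M.after A c n, (∀ d, ¬ M.Step A c' d) ∧ c'.state = M.accept

/-- Every computation path from `c` halts after at most `t` steps. -/
def BoundFrom (M : OracleNTM) (A : Set (List Bool)) (c : M.Cfg) (t : ℕ) : Prop :=
  M.after A c (t + 1) = ∅

/-- The machine passes from the first to the second configuration in the given number of steps, and
has no choice on the way. -/
inductive DetRun (M : OracleNTM) (A : Set (List Bool)) : M.Cfg → M.Cfg → ℕ → Prop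
  | refl (c) : DetRun M A c c 0
  | step {c d e n} (h : ∀ c', M.Step A c c' ↔ c' = d) (hd : DetRun M A d e n) :
      DetRun M A c e (n + 1)

section
variable {M M' : OracleNTM} {A : Set (List Bool)}

theorem cfgsAfter_eq_after (x : List Bool) (n : ℕ) :
    M.cfgsAfter A x n = M.after A (M.init x) n := by
  induction n with
  | zero => rfl
  | succ n ih => simp only [cfgsAfter, after, ih]

theorem accepts_iff (x : List Bool) : M.Accepts A x ↔ M.AcceptsFrom A (M.init x) := by
  simp only [Accepts, AcceptsFrom, cfgsAfter_eq_after]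

theorem haltsWithin_iff (x : List Bool) (t : ℕ) :
    M.HaltsWithin A x t ↔ M.BoundFrom A (M.init x) t := by
  simp only [HaltsWithin, BoundFrom, cfgsAfter_eq_after]

/-- `after` is defined by adding a last step; splitting off the first step instead is what the
recursion for acceptance needs. -/
theorem mem_after_succ' {c c' : M.Cfg} {n : ℕ} :
    c' ∈ M.after A c (n + 1) ↔ ∃ d, M.Step A c d ∧ c' ∈ M.after A d n := by
  induction n generalizing c' with
  | zero => simp [after]
  | succ n ih =>
    constructor
    · rintro ⟨d, hd, h⟩
      obtain ⟨e, he, hde⟩ := ih.1 hd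
      exact ⟨e, he, d, hde, h⟩
    · rintro ⟨e, he, d, hde, h⟩
      exact ⟨d, ih.2 ⟨e, he, hde⟩, h⟩

theorem acceptsFrom_iff {c : M.Cfg} : M.AcceptsFrom A c ↔
    ((∀ d, ¬ M.Step A c d) ∧ c.state = M.accept) ∨ ∃ d, M.Step A c d ∧ M.AcceptsFrom A d := by
  constructor
  · rintro ⟨n, c', hc', h⟩
    cases n with
    | zero =>
      obtain rfl : c' = c := hc'
      exact Or.inl h
    | succ n =>
      obtain ⟨d, hd, h'⟩ := mem_after_succ'.1 hc'
      exact Or.inr ⟨d, hd, n, c', h', h⟩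
  · rintro (h | ⟨d, hd, n, c', hc', h⟩)
    · exact ⟨0, c, rfl, h⟩
    · exact ⟨n + 1, c', mem_after_succ'.2 ⟨d, hd, hc'⟩, h⟩

theorem acceptsFrom_of_unique {c d : M.Cfg} (h : ∀ c', M.Step A c c' ↔ c' = d) :
    M.AcceptsFrom A c ↔ M.AcceptsFrom A d := by
  rw [acceptsFrom_iff]
  simp [h]

theorem boundFrom_of_unique {c d : M.Cfg} (h : ∀ c', M.Step A c c' ↔ c' = d) {t : ℕ}
    (hd : M.BoundFrom A d t) : M.BoundFrom A c (t + 1) := by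
  ext c'
  rw [mem_after_succ']
  simp only [h, exists_eq_left]
  rw [show M.after A d (t + 1) = ∅ from hd]

theorem after_eq_empty_of_le {c : M.Cfg} {m n : ℕ} (hmn : m ≤ n) (h : M.after A c m = ∅) :
    M.after A c n = ∅ := by
  induction hmn with
  | refl => exact h
  | step _ ih => simp [after, ih]

theorem BoundFrom.mono {c : M.Cfg} {t t' : ℕ} (h : M.BoundFrom A c t) (htt : t ≤ t') :
    M.BoundFrom A c t' :=
  after_eq_empty_of_le (by omega) h

theorem DetRun.acceptsFrom_iff {c d : M.Cfg} {n : ℕ} (h : M.DetRun A c d n) :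
    M.AcceptsFrom A c ↔ M.AcceptsFrom A d := by
  induction h with
  | refl => rfl
  | step h _ ih => rw [acceptsFrom_of_unique h, ih]

theorem DetRun.boundFrom {c d : M.Cfg} {n t : ℕ} (h : M.DetRun A c d n)
    (hd : M.BoundFrom A d t) : M.BoundFrom A c (n + t) := by
  induction h with
  | refl => simpa using hd
  | step h _ ih => rw [Nat.add_right_comm]; exact boundFrom_of_unique h (ih hd)

/-- The hypothesis makes `f` a bisimulation with exact step counts. Both acceptance and time bounds
are transferred in this way, to composed machines and to coded machines. -/
theorem after_map {f : M.Cfg → M'.Cfg}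
    (hf : ∀ c c', M'.Step A (f c) c' ↔ ∃ d, M.Step A c d ∧ c' = f d) (c : M.Cfg) (n : ℕ) :
    M'.after A (f c) n = f '' M.after A c n := by
  induction n with
  | zero => simp [after]
  | succ n ih =>
    ext c'
    simp only [after, ih, Set.mem_image, Set.mem_ofPred_eq]
    constructor
    · rintro ⟨_, ⟨d, hd, rfl⟩, h⟩
      obtain ⟨e, he, rfl⟩ := (hf _ _).1 h
      exact ⟨e, ⟨d, hd, he⟩, rfl⟩
    · rintro ⟨e, ⟨d, hd, he⟩, rfl⟩
      exact ⟨f d, ⟨d, hd, rfl⟩, (hf _ _).2 ⟨e, he, rfl⟩⟩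

theorem acceptsFrom_map {f : M.Cfg → M'.Cfg}
    (hf : ∀ c c', M'.Step A (f c) c' ↔ ∃ d, M.Step A c d ∧ c' = f d)
    (hacc : ∀ c, (f c).state = M'.accept ↔ c.state = M.accept) (c : M.Cfg) :
    M'.AcceptsFrom A (f c) ↔ M.AcceptsFrom A c := by
  have hhalt : ∀ c, (∀ d, ¬ M'.Step A (f c) d) ↔ ∀ d, ¬ M.Step A c d := by
    intro c
    simp only [hf]
    exact ⟨fun h d hd => h (f d) ⟨d, hd, rfl⟩, fun h d ⟨e, he, _⟩ => h e he⟩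
  simp only [AcceptsFrom, after_map hf, Set.exists_mem_image, hhalt, hacc]

theorem boundFrom_map {f : M.Cfg → M'.Cfg}
    (hf : ∀ c c', M'.Step A (f c) c' ↔ ∃ d, M.Step A c d ∧ c' = f d) (c : M.Cfg) (t : ℕ) :
    M'.BoundFrom A (f c) t ↔ M.BoundFrom A c t := by
  simp only [BoundFrom, after_map hf, Set.image_eq_empty]

end

end OracleNTM

/-! ### Polynomial bounds -/

/-- Polynomially bounded functions. -/
def PolyBdd (f : ℕ → ℕ) : Prop := ∃ D, ∀ n, f n ≤ (n + 2) ^ D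

namespace PolyBdd

/-- The base `n + 2` is at least 2, so constants, like the factor 2 in a sum, are absorbed by a
larger exponent. -/
theorem const (c : ℕ) : PolyBdd fun _ => c :=
  ⟨c, fun n => Nat.lt_two_pow_self.le.trans (Nat.pow_le_pow_left (by omega) c)⟩

theorem id : PolyBdd fun n => n := ⟨1, fun n => by simp⟩

theorem add {f g : ℕ → ℕ} (hf : PolyBdd f) (hg : PolyBdd g) : PolyBdd fun n => f n + g n := by
  obtain ⟨D, hD⟩ := hf
  obtain ⟨E, hE⟩ := hg
  refine ⟨max D E + 1, fun n => ?_⟩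
  have h1 : (n + 2) ^ D ≤ (n + 2) ^ max D E := Nat.pow_le_pow_right (by omega) (by simp)
  have h2 : (n + 2) ^ E ≤ (n + 2) ^ max D E := Nat.pow_le_pow_right (by omega) (by simp)
  calc f n + g n ≤ (n + 2) ^ max D E * 2 := by linarith [hD n, hE n]
    _ ≤ (n + 2) ^ max D E * (n + 2) := Nat.mul_le_mul_left _ (by omega)
    _ = _ := (pow_succ _ _).symm

theorem mul {f g : ℕ → ℕ} (hf : PolyBdd f) (hg : PolyBdd g) : PolyBdd fun n => f n * g n := by
  obtain ⟨D, hD⟩ := hf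
  obtain ⟨E, hE⟩ := hg
  exact ⟨D + E, fun n => by rw [pow_add]; exact Nat.mul_le_mul (hD n) (hE n)⟩

theorem pow {f : ℕ → ℕ} (hf : PolyBdd f) (e : ℕ) : PolyBdd fun n => f n ^ e := by
  obtain ⟨D, hD⟩ := hf
  exact ⟨D * e, fun n => by rw [pow_mul]; exact Nat.pow_le_pow_left (hD n) e⟩

theorem exists_pow_add {f : ℕ → ℕ} (hf : PolyBdd f) : ∃ d, ∀ n, f n ≤ n ^ d + d := by
  obtain ⟨D, hD⟩ := hf
  -- The summand `3 ^ D` takes care of `n ≤ 1`; for `n ≥ 2` the exponent `2 * D` suffices because `n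
  -- + 2 ≤ n ^ 2`.
  refine ⟨2 * D + 3 ^ D, fun n => (hD n).trans ?_⟩
  rcases Nat.lt_or_ge n 2 with h | h
  · have : (n + 2) ^ D ≤ 3 ^ D := Nat.pow_le_pow_left (by omega) D
    omega
  · have h1 : (n + 2) ^ D ≤ (n ^ 2) ^ D := Nat.pow_le_pow_left (by nlinarith) D
    rw [← pow_mul] at h1
    have h2 : n ^ (2 * D) ≤ n ^ (2 * D + 3 ^ D) := Nat.pow_le_pow_right (by omega) (by simp)
    exact h1.trans (h2.trans (Nat.le_add_right _ _))

end PolyBdd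

/-! ### Straight-line programs and their evaluator -/

instance : Fintype Dir := ⟨{Dir.left, Dir.right}, by rintro (_ | _) <;> simp⟩

/-- Instructions of straight-line programs, which act on a selection tape, a work tape and a query
tape. All of them except `guess`, `mark` and `moveS` take effect only if the scanned symbol on the
selection tape is `some true`. -/
inductive Instr
  | guess
  | mark (b : Bool)
  | moveS (d : Dir)
  | check (c : Option Bool)
  | write (c : Option Bool)
  | moveW (d : Dir)
  | ask (b : Bool)
  | query
  deriving Fintype

/-- The symbol on the selection tape that stands for a truth value. -/
def markSym (b : Bool) : Option Bool := if b then some true else none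

/-- The contents of the tapes on which straight-line programs act. -/
structure SLState where
  S : Tape (Option Bool)
  W : Tape (Option Bool)
  q : List Bool

open Classical in
/-- The possible results of an instruction. -/
noncomputable def Instr.exec (A : Set (List Bool)) : Instr → SLState → Set SLState
  | guess, s => {{s with S := s.S.write none}, {s with S := s.S.write (some true)}}
  | mark b, s => {{s with S := s.S.write (markSym b)}}
  | moveS d, s => {{s with S := s.S.move d}}
  -- A failed check has no result at all, so it kills the computation path.
  | check c, s => {t | t = s ∧ (s.S.head = some true → s.W.head = c)}
  | write c, s => {if s.S.head = some true then {s with W := s.W.write c} else s}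
  | moveW d, s => {if s.S.head = some true then {s with W := s.W.move d} else s}
  | ask b, s => {if s.S.head = some true then {s with q := s.q ++ [b]} else s}
  | query, s => {if s.S.head = some true then
      {s with W := s.W.write (some (decide (s.q ∈ A))), q := []} else s}

/-- The possible results of a straight-line program. -/
noncomputable def execs (A : Set (List Bool)) : List Instr → SLState → Set SLState
  | [], s => {s}
  | i :: p, s => {u | ∃ t ∈ i.exec A s, u ∈ execs A p t}

theorem mem_execs_append {A : Set (List Bool)} {p p' : List Instr} {s u : SLState} :
    u ∈ execs A (p ++ p') s ↔ ∃ t ∈ execs A p s, u ∈ execs A p' t := by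
  induction p generalizing s with
  | nil => simp [execs]
  | cons i p ih =>
    simp only [List.cons_append, execs, Set.mem_ofPred_eq, ih]
    constructor
    · rintro ⟨t, ht, v, hv, h⟩
      exact ⟨v, ⟨t, ht, hv⟩, h⟩
    · rintro ⟨v, ⟨t, ht, hv⟩, h⟩
      exact ⟨t, ht, v, hv, h⟩

theorem card_instr_pos : 0 < Fintype.card Instr := Fintype.card_pos_iff.2 ⟨.guess⟩

/-- A numbering of the instructions. -/
noncomputable def instrIdx : Instr ≃ Fin (Fintype.card Instr) := Fintype.equivFin Instr

/-- Instruction number `i` is written as `i` ones followed by a zero. -/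
noncomputable def Instr.code (i : Instr) : List Bool :=
  List.replicate (instrIdx i) true ++ [false]

/-- The code of a straight-line program. -/
noncomputable def progCode (p : List Instr) : List Bool := p.flatMap Instr.code

/-- States of the evaluator: `rd i` when `i` ones of an instruction code have been read. -/
inductive EvalState
  | rd (i : Fin (Fintype.card Instr))
  | qry
  | yes
  | no
  | acc
  deriving Fintype

namespace EvalState

/-- The state between two instructions. -/
def ready : EvalState := rd ⟨0, card_instr_pos⟩

end EvalState

open EvalState

/-- Actions of a machine with three work tapes, tape by tape. -/
def mkAction {Q : Type} (q : Q) (w₀ : Option Bool) (m₀ : Option Dir) (w₁ : Option Bool)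
    (m₁ : Option Dir) (w₂ : Option Bool) (m₂ : Option Dir) (ask : Option Bool) : Action Q 2 :=
  ⟨q, ![w₀, w₁, w₂], ![m₀, m₁, m₂], ask⟩

/-- The actions of the evaluator that carry out an instruction. -/
def instrActions (i : Instr) (σ : Fin 3 → Option Bool) : Set (Action EvalState 2) :=
  let mk (q : EvalState) (s : Option Bool) (ms : Option Dir) (w : Option Bool) (mw : Option Dir)
    (ask : Option Bool) := mkAction q (σ 0) (some .right) s ms w mw ask
  let skip := mk ready (σ 1) none (σ 2) none none
  match i with
  | .guess => {mk ready none none (σ 2) none none, mk ready (some true) none (σ 2) none none}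
  | .mark b => {mk ready (markSym b) none (σ 2) none none}
  | .moveS d => {mk ready (σ 1) (some d) (σ 2) none none}
  | .check c => {a | a = skip ∧ (σ 1 = some true → σ 2 = c)}
  | .write c => {if σ 1 = some true then mk ready (σ 1) none c none none else skip}
  | .moveW d => {if σ 1 = some true then mk ready (σ 1) none (σ 2) (some d) none else skip}
  | .ask b => {if σ 1 = some true then mk ready (σ 1) none (σ 2) none (some b) else skip}
  | .query => {if σ 1 = some true then mk qry (σ 1) none (σ 2) none none else skip}

/-- The transitions of the evaluator. -/
noncomputable def evalδ : EvalState → (Fin 3 → Option Bool) → Set (Action EvalState 2)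
  | rd i, σ =>
    match σ 0 with
    | some true => {a | ∃ h : i.val + 1 < Fintype.card Instr,
        a = mkAction (rd ⟨i.val + 1, h⟩) (σ 0) (some .right) (σ 1) none (σ 2) none none}
    | some false => instrActions (instrIdx.symm i) σ
    -- Acceptance is possible only between two instructions; on an incomplete code the evaluator is
    -- stuck in a non-accepting state.
    | none => {a | i.val = 0 ∧ a = mkAction acc (σ 0) none (σ 1) none (σ 2) none none}
  | yes, σ => {mkAction ready (σ 0) none (σ 1) none (some true) none none}
  | no, σ => {mkAction ready (σ 0) none (σ 1) none (some false) none none}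
  | acc, _ => ∅
  | qry, _ => ∅

/-- The evaluator of straight-line programs: it carries out the program whose code is the input, and
accepts when it arrives at the end. -/
noncomputable def evaluator : OracleNTM where
  Q := EvalState
  finite := inferInstance
  k := 2
  start := ready
  accept := acc
  query := qry
  yes := yes
  no := no
  δ := evalδ

/-- Configurations of the evaluator. -/
noncomputable def evalCfg (q : EvalState) (T : Tape (Option Bool)) (s : SLState) : evaluator.Cfg :=
  ⟨q, ![T, s.S, s.W], s.q⟩

/-- The part of an action that concerns a single tape. -/
def actTape (a : Option Bool) (m : Option Dir) (T : Tape (Option Bool)) : Tape (Option Bool) :=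
  match m with
  | none => T.write a
  | some d => (T.write a).move d

/-- The evaluator accepts from a configuration. -/
def EvalAccepts (A : Set (List Bool)) (q : EvalState) (T : Tape (Option Bool)) (s : SLState) :
    Prop :=
  evaluator.AcceptsFrom A (evalCfg q T s)

theorem act_evalCfg (q : EvalState) (T : Tape (Option Bool)) (s : SLState)
    (a : Action EvalState 2) :
    evaluator.act (evalCfg q T s) a = evalCfg a.next (actTape (a.write 0) (a.move 0) T)
      ⟨actTape (a.write 1) (a.move 1) s.S, actTape (a.write 2) (a.move 2) s.W,
        s.q ++ a.ask.toList⟩ := by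
  simp only [OracleNTM.act, evalCfg]
  congr 1
  funext i
  change Fin 3 at i
  fin_cases i <;> rfl

theorem step_evalCfg {A : Set (List Bool)} {q : EvalState} (hq : q ≠ qry)
    {T : Tape (Option Bool)} {s : SLState} {d : evaluator.Cfg} :
    evaluator.Step A (evalCfg q T s) d ↔
      ∃ a ∈ evalδ q ![T.head, s.S.head, s.W.head],
        d = evalCfg a.next (actTape (a.write 0) (a.move 0) T)
          ⟨actTape (a.write 1) (a.move 1) s.S, actTape (a.write 2) (a.move 2) s.W,
            s.q ++ a.ask.toList⟩ := by
  have h : (fun i => ((evalCfg q T s).tape i).head) = ![T.head, s.S.head, s.W.head] := by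
    funext i
    change Fin 3 at i
    fin_cases i <;> rfl
  simp only [OracleNTM.Step]
  rw [h]
  constructor
  · rintro (h | ⟨-, a, ha, rfl⟩)
    · exact absurd h.1 hq
    · exact ⟨a, ha, act_evalCfg q T s a⟩
  · rintro ⟨a, ha, rfl⟩
    exact Or.inr ⟨hq, a, ha, (act_evalCfg q T s a).symm⟩

theorem evalAccepts_iff {A : Set (List Bool)} {q : EvalState} (hq : q ≠ qry) (hq' : q ≠ acc)
    {T : Tape (Option Bool)} {s : SLState} :
    EvalAccepts A q T s ↔ ∃ a ∈ evalδ q ![T.head, s.S.head, s.W.head],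
      EvalAccepts A a.next (actTape (a.write 0) (a.move 0) T)
        ⟨actTape (a.write 1) (a.move 1) s.S, actTape (a.write 2) (a.move 2) s.W,
          s.q ++ a.ask.toList⟩ := by
  rw [EvalAccepts, OracleNTM.acceptsFrom_iff]
  simp only [step_evalCfg hq]
  constructor
  · rintro (h | ⟨d, ⟨a, ha, rfl⟩, h⟩)
    · exact absurd h.2 hq'
    · exact ⟨a, ha, h⟩
  · rintro ⟨a, ha, h⟩
    exact Or.inr ⟨_, ⟨a, ha, rfl⟩, h⟩

theorem evalAccepts_qry {A : Set (List Bool)} {T : Tape (Option Bool)} {s : SLState} :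
    EvalAccepts A qry T s ↔ EvalAccepts A ready T
      ⟨s.S, s.W.write (some (open Classical in decide (s.q ∈ A))), []⟩ := by
  classical
  have h : ∀ d, evaluator.Step A (evalCfg qry T s) d ↔
      d = evalCfg (if s.q ∈ A then yes else no) T ⟨s.S, s.W, []⟩ := by
    intro d
    exact ⟨fun h => h.elim (fun h => h.2) fun h => absurd rfl h.1, fun h => Or.inl ⟨rfl, h⟩⟩
  rw [EvalAccepts, OracleNTM.acceptsFrom_of_unique h, ← EvalAccepts]
  by_cases hA : s.q ∈ A <;>
    simp [hA, evalAccepts_iff, evalδ, mkAction, actTape, Tape.write_self]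

theorem evalAccepts_acc {A : Set (List Bool)} {T : Tape (Option Bool)} {s : SLState} :
    EvalAccepts A acc T s := by
  refine OracleNTM.acceptsFrom_iff.2 (Or.inl ⟨fun d hd => ?_, rfl⟩)
  obtain ⟨a, ha, -⟩ := (step_evalCfg (by simp)).1 hd
  exact ha

/-- The input tape with the reversed list `l` to the left of the head. -/
abbrev inputTape (l : List (Option Bool)) (r : List Bool) : Tape (Option Bool) :=
  Tape.mk₂ l (r.map some)

theorem mk₂_move_right (l r : List (Option Bool)) (a : Option Bool) :
    (Tape.mk₂ l (a :: r)).move .right = Tape.mk₂ (a :: l) r := by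
  simp [Tape.mk₂, Tape.move_right_mk']

theorem mk₂_move_left (l r : List (Option Bool)) (a : Option Bool) :
    (Tape.mk₂ (a :: l) r).move .left = Tape.mk₂ l (a :: r) := by
  simp [Tape.mk₂, Tape.move_left_mk']

theorem mk₂_head (l r : List (Option Bool)) (a : Option Bool) :
    (Tape.mk₂ l (a :: r)).head = a := by
  simp [Tape.mk₂]

theorem mk₂_head_nil (l : List (Option Bool)) : (Tape.mk₂ l []).head = none := by
  simp [Tape.mk₂]
  rfl

theorem mk₂_write (l r : List (Option Bool)) (a b : Option Bool) :
    (Tape.mk₂ l (a :: r)).write b = Tape.mk₂ l (b :: r) := by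
  simp [Tape.mk₂, Tape.write_mk']

/-- The evaluator never returns to symbols that it has read, so the left part `l'` of the input tape
need not be specified. -/
theorem evalAccepts_read_ones {A : Set (List Bool)} (s : SLState) (r : List Bool) (j : ℕ) :
    ∀ (l : List (Option Bool)) (i : Fin (Fintype.card Instr)) (h : i.val + j < Fintype.card Instr),
    ∃ l', (EvalAccepts A (rd i) (inputTape l (List.replicate j true ++ r)) s ↔
      EvalAccepts A (rd ⟨i.val + j, h⟩) (inputTape l' r) s) := by
  induction j with
  | zero => exact fun l i h => ⟨l, by simp⟩
  | succ j ih =>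
    intro l i h
    obtain ⟨l', hl'⟩ := ih (some true :: l) ⟨i.val + 1, by omega⟩ (by simp; omega)
    refine ⟨l', ?_⟩
    have h1 : i.val + 1 < Fintype.card Instr := by omega
    rw [evalAccepts_iff (by simp) (by simp)]
    simp only [inputTape, List.replicate_succ, List.cons_append, List.map_cons, mk₂_head, evalδ,
      Matrix.cons_val_zero, Set.mem_ofPred_eq, h1, exists_true_left]
    simp only [exists_eq_left, mkAction, actTape, Matrix.cons_val, mk₂_write, mk₂_move_right,
      Tape.write_self, Option.toList_none, List.append_nil]
    rw [hl']
    simp only [Nat.add_assoc, Nat.add_comm 1]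

theorem evalAccepts_instr {A : Set (List Bool)} (s : SLState) (r : List Bool)
    (l : List (Option Bool)) (i : Instr) :
    EvalAccepts A (rd (instrIdx i)) (inputTape l (false :: r)) s ↔
      ∃ t ∈ i.exec A s, EvalAccepts A ready (inputTape (some false :: l) r) t := by
  have hW : s.W.write s.W.head = s.W := Tape.write_self _
  have hS : s.S.write s.S.head = s.S := Tape.write_self _
  rw [evalAccepts_iff (by simp) (by simp)]
  simp only [inputTape, List.map_cons, mk₂_head, evalδ, Matrix.cons_val_zero, Equiv.symm_apply_apply]
  cases i <;> by_cases h : s.S.head = some true <;>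
    simp [instrActions, Instr.exec, mkAction, actTape, mk₂_write, mk₂_move_right, h, hW,
      evalAccepts_qry]
  all_goals simp [← h, hS]

theorem evalAccepts_progCode {A : Set (List Bool)} (p : List Instr) (s : SLState)
    (l : List (Option Bool)) :
    EvalAccepts A ready (inputTape l (progCode p)) s ↔ (execs A p s).Nonempty := by
  induction p generalizing s l with
  | nil =>
    simp only [execs, Set.singleton_nonempty, iff_true]
    rw [evalAccepts_iff (by simp [ready]) (by simp [ready])]
    simp only [inputTape, progCode, List.flatMap_nil, List.map_nil, mk₂_head_nil, evalδ, ready,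
      Matrix.cons_val_zero]
    exact ⟨_, ⟨trivial, rfl⟩, evalAccepts_acc⟩
  | cons i p ih =>
    obtain ⟨l', hl'⟩ := evalAccepts_read_ones (A := A) s (false :: progCode p) (instrIdx i) l
      ⟨0, card_instr_pos⟩ (by simp)
    have h : progCode (i :: p) = List.replicate (instrIdx i) true ++ false :: progCode p := by
      simp [progCode, Instr.code]
    simp only [zero_add, Fin.eta] at hl'
    rw [h, ready, hl', evalAccepts_instr]
    simp only [ih, execs]
    exact ⟨fun ⟨t, ht, u, hu⟩ => ⟨u, t, ht, hu⟩, fun ⟨u, t, ht, hu⟩ => ⟨t, ht, u, hu⟩⟩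

/-- The initial state of straight-line programs. -/
def SLState.init : SLState := ⟨Tape.mk₁ [], Tape.mk₁ [], []⟩

theorem evaluator_init (w : List Bool) :
    evaluator.init w = evalCfg ready (inputTape [] w) .init := by
  simp only [OracleNTM.init, evalCfg]
  congr 1
  funext i
  change Fin 3 at i
  fin_cases i <;> rfl

theorem progCode_mem_language {A : Set (List Bool)} (p : List Instr) :
    progCode p ∈ evaluator.language A ↔ (execs A p .init).Nonempty := by
  rw [← evalAccepts_progCode p .init [], EvalAccepts, ← evaluator_init, ← OracleNTM.accepts_iff]
  rfl

/-- A bound for the number of steps that the evaluator makes without moving on the input tape. -/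
def EvalState.rank : EvalState → ℕ
  | rd _ => 1
  | qry => 3
  | yes => 2
  | no => 2
  | acc => 0

theorem instrActions_spec {i : Instr} {σ : Fin 3 → Option Bool} {a : Action EvalState 2}
    (ha : a ∈ instrActions i σ) :
    a.write 0 = σ 0 ∧ a.move 0 = some .right ∧ a.next.rank ≤ 3 := by
  cases i <;> by_cases h : σ 1 = some true <;> simp [instrActions, mkAction, h] at ha
  all_goals first
    | (subst ha; simp [EvalState.rank, ready])
    | (rcases ha with rfl | rfl <;> simp [EvalState.rank, ready])

theorem evalδ_spec {q : EvalState} {σ : Fin 3 → Option Bool} {a : Action EvalState 2}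
    (ha : a ∈ evalδ q σ) : a.write 0 = σ 0 ∧
      ((a.move 0 = none ∧ a.next.rank < q.rank) ∨
        (a.move 0 = some .right ∧ σ 0 ≠ none ∧ a.next.rank < q.rank + 3)) := by
  cases q with
  | rd i =>
    simp only [evalδ] at ha
    split at ha
    · next h =>
      obtain ⟨_, rfl⟩ := ha
      simp [mkAction, EvalState.rank, h]
    · next h =>
      obtain ⟨h1, h2, h3⟩ := instrActions_spec ha
      refine ⟨h1, Or.inr ⟨h2, by simp [h], ?_⟩⟩
      exact Nat.lt_of_le_of_lt h3 (by simp [EvalState.rank])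
    · obtain ⟨_, rfl⟩ := ha
      simp [mkAction, EvalState.rank]
  | qry => exact absurd ha (Set.notMem_empty _)
  | yes => obtain rfl : a = _ := ha; simp [mkAction, EvalState.rank, ready]
  | no => obtain rfl : a = _ := ha; simp [mkAction, EvalState.rank, ready]
  | acc => exact absurd ha (Set.notMem_empty _)

/-- The quantity `3 * r.length + q.rank` is a potential: a step without movement on the input tape
lowers the rank, and a step to the right consumes a symbol worth 3 while the rank grows by at most
2. The bound does not involve the oracle. -/
theorem evaluator_after {A : Set (List Bool)} (w : List Bool) (n : ℕ) {c : evaluator.Cfg}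
    (hc : c ∈ evaluator.after A (evaluator.init w) n) :
    ∃ q l r s, c = evalCfg q (inputTape l r) s ∧ n + 3 * r.length + q.rank ≤ 3 * w.length + 1 := by
  induction n generalizing c with
  | zero =>
    obtain rfl : c = _ := hc
    exact ⟨_, _, _, _, evaluator_init w, by simp [EvalState.rank, ready]⟩
  | succ n ih =>
    obtain ⟨d, hd, h⟩ := hc
    obtain ⟨q, l, r, s, rfl, hr⟩ := ih hd
    by_cases hq : q = qry
    · subst hq
      obtain ⟨-, rfl⟩ : _ ∧ c = _ := h.resolve_right fun h => h.1 rfl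
      refine ⟨open Classical in if s.q ∈ A then yes else no, l, r, ⟨s.S, s.W, []⟩, rfl, ?_⟩
      split <;> simp only [EvalState.rank] at hr ⊢ <;> omega
    · obtain ⟨a, ha, rfl⟩ := (step_evalCfg hq).1 h
      obtain ⟨h1, ⟨h2, h3⟩ | ⟨h2, h3, h4⟩⟩ := evalδ_spec ha
      · rw [h1, h2]
        simp only [actTape, Matrix.cons_val_zero, Tape.write_self]
        exact ⟨_, _, _, _, rfl, by omega⟩
      · cases r with
        | nil => exact absurd (mk₂_head_nil l) h3
        | cons b r =>
          rw [h1, h2]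
          simp only [actTape, Matrix.cons_val_zero, Tape.write_self, inputTape, List.map_cons,
            mk₂_move_right]
          simp only [List.length_cons] at hr
          exact ⟨_, _, _, _, rfl, by omega⟩

theorem evaluator_polyTime : ∃ d, ∀ A, evaluator.PolyTime A d := by
  obtain ⟨d, hd⟩ := (((PolyBdd.const 3).mul PolyBdd.id).add (PolyBdd.const 1)).exists_pow_add
  refine ⟨d, fun A w => ?_⟩
  rw [OracleNTM.haltsWithin_iff]
  refine OracleNTM.BoundFrom.mono (t := 3 * w.length + 1) ?_ (hd _)
  ext c
  simp only [Set.mem_empty_iff_false, iff_false]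
  intro hc
  obtain ⟨q, l, r, s, -, h⟩ := evaluator_after w _ hc
  omega

/-! ### Programs that guess a list of rules and check it tape by tape -/

/-- Building blocks of straight-line programs that depend on a string `x` and a number `T`: a fixed
program, a fixed program repeated `T` times, or a program that is given bit by bit by `x`. -/
inductive Piece
  | lit (p : List Instr)
  | rep (p : List Instr)
  | bits (f : Bool → List Instr)

/-- The program that is given by a building block. -/
def Piece.prog (T : ℕ) (x : List Bool) : Piece → List Instr
  | lit p => p
  | rep p => (List.replicate T p).flatten
  | bits f => x.flatMap f

/-- The program that is given by a list of building blocks. -/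
def piecesProg (ps : List Piece) (T : ℕ) (x : List Bool) : List Instr :=
  ps.flatMap (Piece.prog T x)

/-- Simultaneous operations on a family of tapes and a query tape: on every tape the symbol that has
to be scanned, the symbol written, and the head movement; the bit appended to the string on the
query tape; and the answer that the oracle has to give, if it is asked. -/
@[ext]
structure Rule (ι : Type) where
  old : ι → Option Bool
  new : ι → Option Bool
  move : ι → Option Dir
  ask : Option Bool
  answer : Option Bool

instance {ι : Type} [Finite ι] : Finite (Rule ι) := by
  have : Finite (Option Dir) := inferInstance
  refine Finite.of_injective
    (fun r : Rule ι => (r.old, r.new, r.move, r.ask, r.answer)) fun r s h => ?_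
  simp only [Prod.mk.injEq] at h
  exact Rule.ext h.1 h.2.1 h.2.2.1 h.2.2.2.1 h.2.2.2.2

/-- The effect of a list of rules on one tape. -/
def tapeRun {ι : Type} (i : ι) : List (Rule ι) → Tape (Option Bool) → Option (Tape (Option Bool))
  | [], W => some W
  | r :: rs, W =>
    if W.head = r.old i then tapeRun i rs (actTape (r.new i) (r.move i) W) else none

open Classical in
/-- The effect of a list of rules on the query tape. -/
noncomputable def queryRun {ι : Type} (A : Set (List Bool)) :
    List (Rule ι) → List Bool → Option (List Bool)
  | [], q => some q
  | r :: rs, q =>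
    match r.answer with
    | none => queryRun A rs (q ++ r.ask.toList)
    | some b => if decide (q ∈ A) = b then queryRun A rs [] else none

section
variable {ι : Type}

/-- Guess whether the rule is to be applied, and if so carry out its operation on the query tape. -/
def selectProg (r : Rule ι) : List Instr :=
  .guess :: (match r.answer with
    | none => r.ask.toList.map .ask
    | some b => [.query, .check (some b), .write none]) ++ [.moveS .right]

/-- Apply a rule to tape `i`, if it is selected. -/
def forwardProg (i : ι) (r : Rule ι) : List Instr :=
  [.check (r.old i), .write (r.new i)] ++ (r.move i).toList.map .moveW ++ [.moveS .right]

/-- The opposite direction. -/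
def oppDir : Dir → Dir
  | .left => .right
  | .right => .left

/-- Undo the effect of a rule on tape `i`, if it is selected. -/
def backwardProg (i : ι) (r : Rule ι) : List Instr :=
  .moveS .left :: (r.move i).toList.map (fun d => .moveW (oppDir d)) ++ [.write (r.old i)]

/-- The rules that are selected. -/
def chosen (al : List (Rule ι × Bool)) : List (Rule ι) := (al.filter (·.2)).map (·.1)

/-- The contents of the selection tape. -/
def marks (al : List (Rule ι × Bool)) : List (Option Bool) := al.map fun a => markSym a.2

variable {A : Set (List Bool)}

theorem mk₂_write_nil (l : List (Option Bool)) (b : Option Bool) :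
    (Tape.mk₂ l []).write b = Tape.mk₂ l [b] := by
  simp [Tape.mk₂]

theorem listBlank_mk_none : (ListBlank.mk [none] : ListBlank (Option Bool)) = ListBlank.mk [] :=
  Quotient.sound (Or.inr ⟨1, rfl⟩)

theorem mk₂_none_right (l : List (Option Bool)) : Tape.mk₂ l [none] = Tape.mk₂ l [] := by
  simp only [Tape.mk₂, listBlank_mk_none]

theorem mk₂_none_left (r : List (Option Bool)) : Tape.mk₂ [none] r = Tape.mk₂ [] r := by
  simp only [Tape.mk₂, listBlank_mk_none]

theorem mk₂_nil_move_left (r : List (Option Bool)) :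
    (Tape.mk₂ [] r).move .left = Tape.mk₂ [] (none :: r) := by
  rw [← mk₂_none_left, mk₂_move_left]

theorem mk₁_eq_mk₂ (l : List (Option Bool)) : Tape.mk₁ l = Tape.mk₂ [] l := rfl

theorem mk₁_nil_write_none : (Tape.mk₁ [] : Tape (Option Bool)).write none = Tape.mk₁ [] := by
  rw [mk₁_eq_mk₂, mk₂_write_nil, mk₂_none_right]

theorem write_write (T : Tape (Option Bool)) (a b : Option Bool) :
    (T.write a).write b = T.write b := rfl

theorem head_write (T : Tape (Option Bool)) (a : Option Bool) : (T.write a).head = a := rfl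

theorem markSym_true : markSym true = some true := rfl

theorem markSym_false : markSym false = none := rfl

/-- The query tape cannot be rewound, so it is treated at guessing time. The work tape only receives
the oracle's answer for the check, and it is blanked again afterwards. -/
theorem mem_execs_selectProg (r : Rule ι) (l : List (Option Bool)) (q : List Bool) (u : SLState) :
    u ∈ execs A (selectProg r) ⟨Tape.mk₂ l [], Tape.mk₁ [], q⟩ ↔
      ∃ (b : Bool) (q' : List Bool), queryRun A (chosen [(r, b)]) q = some q' ∧
        u = ⟨Tape.mk₂ (markSym b :: l) [], Tape.mk₁ [], q'⟩ := by
  obtain ⟨o, n, m, ask, ans⟩ := r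
  rcases ans with _ | b
  · rcases ask with _ | c <;>
    simp [selectProg, execs, Instr.exec, chosen, queryRun, mk₂_write_nil, mk₂_head,
      mk₂_move_right, markSym]
  · by_cases hq : q ∈ A <;> cases b <;>
    simp [selectProg, execs, Instr.exec, chosen, queryRun, mk₂_write_nil, mk₂_head,
      mk₂_move_right, markSym, hq, head_write, write_write, mk₁_nil_write_none]

theorem queryRun_append (rs rs' : List (Rule ι)) (q : List Bool) :
    queryRun A (rs ++ rs') q = (queryRun A rs q).bind (queryRun A rs') := by
  induction rs generalizing q with
  | nil => rfl
  | cons r rs ih =>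
    simp only [List.cons_append, queryRun]
    split
    · exact ih _
    · split
      · exact ih _
      · rfl

theorem chosen_cons (a : Rule ι × Bool) (al : List (Rule ι × Bool)) :
    chosen (a :: al) = chosen [a] ++ chosen al := by
  simp only [chosen, ← List.map_append, ← List.filter_append, List.singleton_append]

/-- All nondeterminism is confined to this phase. Later pieces read the choices from the selection
tape, and each of them either fails or has exactly one result. -/
theorem mem_execs_select (rs : List (Rule ι)) (l : List (Option Bool)) (q : List Bool)
    (u : SLState) :
    u ∈ execs A (rs.flatMap selectProg) ⟨Tape.mk₂ l [], Tape.mk₁ [], q⟩ ↔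
      ∃ al : List (Rule ι × Bool), al.map (·.1) = rs ∧ ∃ q', queryRun A (chosen al) q = some q' ∧
        u = ⟨Tape.mk₂ ((marks al).reverse ++ l) [], Tape.mk₁ [], q'⟩ := by
  induction rs generalizing l q with
  | nil => simp [execs, chosen, queryRun, marks]
  | cons r rs ih =>
    simp only [List.flatMap_cons, mem_execs_append, mem_execs_selectProg]
    constructor
    · rintro ⟨_, ⟨b, q', hq', rfl⟩, h⟩
      obtain ⟨al, hal, q'', hq'', rfl⟩ := (ih _ _).1 h
      refine ⟨(r, b) :: al, by simp [hal], q'', ?_, by simp [marks]⟩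
      rw [chosen_cons, queryRun_append, hq']
      exact hq''
    · rintro ⟨al, hal, q'', hq'', rfl⟩
      obtain ⟨⟨r', b⟩, al, rfl, rfl, rfl⟩ := List.map_eq_cons_iff.1 hal
      rw [chosen_cons, queryRun_append, Option.bind_eq_some_iff] at hq''
      obtain ⟨q', hq', hq''⟩ := hq''
      exact ⟨_, ⟨b, q', hq', rfl⟩, (ih _ _).2 ⟨al, rfl, q'', hq'', by simp [marks]⟩⟩

theorem mem_execs_moveS_left (xs l r : List (Option Bool)) (W : Tape (Option Bool))
    (q : List Bool) (n : ℕ) (hn : n = xs.length) (u : SLState) :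
    u ∈ execs A (List.replicate n (.moveS .left)) ⟨Tape.mk₂ (xs.reverse ++ l) r, W, q⟩ ↔
      u = ⟨Tape.mk₂ l (xs ++ r), W, q⟩ := by
  subst hn
  induction xs using List.reverseRecOn generalizing r with
  | nil => rfl
  | append_singleton xs x ih =>
    rw [List.length_append, List.length_singleton, List.replicate_succ]
    simp only [List.reverse_append, List.reverse_singleton, List.nil_append,
      List.cons_append, execs, Instr.exec, Set.mem_singleton_iff, exists_eq_left,
      mk₂_move_left, Set.mem_ofPred_eq, ih, List.append_assoc]

theorem mem_execs_forwardProg (i : ι) (a : Rule ι × Bool) (l r : List (Option Bool))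
    (W : Tape (Option Bool)) (q : List Bool) (u : SLState) :
    u ∈ execs A (forwardProg i a.1) ⟨Tape.mk₂ l (markSym a.2 :: r), W, q⟩ ↔
      ∃ W', tapeRun i (chosen [a]) W = some W' ∧
        u = ⟨Tape.mk₂ (markSym a.2 :: l) r, W', q⟩ := by
  obtain ⟨⟨o, n, m, ask, ans⟩, b⟩ := a
  rcases h : m i with _ | d <;> cases b <;>
    simp [forwardProg, execs, Instr.exec, chosen, tapeRun, mk₂_head, mk₂_move_right, markSym,
      actTape, h, and_assoc]

theorem tapeRun_append (i : ι) (rs rs' : List (Rule ι)) (W : Tape (Option Bool)) :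
    tapeRun i (rs ++ rs') W = (tapeRun i rs W).bind (tapeRun i rs') := by
  induction rs generalizing W with
  | nil => rfl
  | cons r rs ih =>
    simp only [List.cons_append, tapeRun]
    split
    · exact ih _
    · rfl

theorem mem_execs_forward (i : ι) (al : List (Rule ι × Bool)) (l r : List (Option Bool))
    (W : Tape (Option Bool)) (q : List Bool) (u : SLState) :
    u ∈ execs A ((al.map (·.1)).flatMap (forwardProg i)) ⟨Tape.mk₂ l (marks al ++ r), W, q⟩ ↔
      ∃ W', tapeRun i (chosen al) W = some W' ∧
        u = ⟨Tape.mk₂ ((marks al).reverse ++ l) r, W', q⟩ := by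
  induction al generalizing l W with
  | nil => simp [execs, chosen, tapeRun, marks]
  | cons a al ih =>
    rw [chosen_cons, tapeRun_append, List.map_cons, List.flatMap_cons, mem_execs_append]
    simp only [marks, List.map_cons, List.cons_append, mem_execs_forwardProg] at ih ⊢
    simp only [Option.bind_eq_some_iff, List.reverse_cons, List.append_assoc,
      List.singleton_append]
    constructor
    · rintro ⟨_, ⟨W', hW', rfl⟩, h⟩
      obtain ⟨W'', hW'', rfl⟩ := (ih _ _).1 h
      exact ⟨W'', ⟨W', hW', hW''⟩, rfl⟩
    · rintro ⟨W'', ⟨W', hW', hW''⟩, rfl⟩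
      exact ⟨_, ⟨W', hW', rfl⟩, (ih _ _).2 ⟨W'', hW'', rfl⟩⟩

theorem move_oppDir (T : Tape (Option Bool)) (d : Dir) : (T.move d).move (oppDir d) = T := by
  cases d
  · exact Tape.move_left_right T
  · exact Tape.move_right_left T

/-- Rules are reversible: the forward run has checked that the overwritten symbol was `r.old i`, so
moving back and writing that symbol restores the tape. -/
theorem mem_execs_backwardProg (i : ι) (a : Rule ι × Bool) (l r : List (Option Bool))
    {W W' : Tape (Option Bool)} (hW : tapeRun i (chosen [a]) W = some W') (q : List Bool)
    (u : SLState) :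
    u ∈ execs A (backwardProg i a.1) ⟨Tape.mk₂ (markSym a.2 :: l) r, W', q⟩ ↔
      u = ⟨Tape.mk₂ l (markSym a.2 :: r), W, q⟩ := by
  obtain ⟨⟨o, n, m, ask, ans⟩, b⟩ := a
  cases b
  · obtain rfl : W = W' := Option.some.inj hW
    rcases h : m i with _ | d <;>
      simp [backwardProg, execs, Instr.exec, mk₂_head, mk₂_move_left, markSym, h]
  · rcases h : m i with _ | d <;>
      simp [chosen, tapeRun, actTape, h] at hW <;> obtain ⟨hW1, rfl⟩ := hW <;>
      simp [backwardProg, execs, Instr.exec, mk₂_head, mk₂_move_left, markSym,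
        h, move_oppDir, write_write, ← hW1, Tape.write_self]

theorem mem_execs_backward (i : ι) (al : List (Rule ι × Bool)) (l r : List (Option Bool))
    {W W' : Tape (Option Bool)} (hW : tapeRun i (chosen al) W = some W') (q : List Bool)
    (u : SLState) :
    u ∈ execs A ((al.map (·.1)).reverse.flatMap (backwardProg i))
        ⟨Tape.mk₂ ((marks al).reverse ++ l) r, W', q⟩ ↔
      u = ⟨Tape.mk₂ l (marks al ++ r), W, q⟩ := by
  induction al generalizing l W u with
  | nil =>
    obtain rfl : W = W' := Option.some.inj hW
    simp [execs, marks]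
  | cons a al ih =>
    rw [chosen_cons, tapeRun_append, Option.bind_eq_some_iff] at hW
    obtain ⟨V, hV, hW⟩ := hW
    simp only [marks, List.map_cons, List.reverse_cons, List.flatMap_append, mem_execs_append,
      List.append_assoc, List.singleton_append] at ih ⊢
    simp only [ih _ hW, exists_eq_left, List.flatMap_cons, List.flatMap_nil, List.append_nil,
      List.cons_append, mem_execs_backwardProg i a _ _ hV]

end

section
variable {ι : Type} {A : Set (List Bool)}

/-- Run the selected rules on the blank tape `i`, check the symbol that is scanned at the end if
this is required, and undo everything. -/
def tapePieces (R : List (Rule ι)) (chk : ι → Option (Option Bool)) (i : ι) : List Piece :=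
  [.rep (R.flatMap (forwardProg i)),
    -- After the forward run the selection head is on the blank cell behind the marks. It is marked
    -- temporarily, because a check has no effect in an unmarked cell.
    .lit (.mark true :: ((chk i).toList.map .check ++ [.mark false])),
    .rep (R.reverse.flatMap (backwardProg i))]

/-- Write `x` on the work tape, and run the selected rules on it as tape `i`. -/
def inputPieces (R : List (Rule ι)) (i : ι) : List Piece :=
  -- The cell to the left of all marks serves as a switch that enables writing `x` and rewinding.
  -- This tape is treated last, so nothing has to be undone.
  [.lit [.moveS .left, .mark true], .bits fun b => [.write (some b), .moveW .right],
    .bits fun _ => [.moveW .left], .lit [.mark false, .moveS .right],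
    .rep (R.flatMap (forwardProg i))]

/-- The straight-line program that guesses a list of rules and checks that it is applicable to the
tapes `i₀` and `is`, of which `i₀` contains the input and the others are blank. -/
def rulesPieces (R : List (Rule ι)) (is : List ι) (i₀ : ι) (chk : ι → Option (Option Bool)) :
    List Piece :=
  .rep (R.flatMap selectProg) :: .rep (R.flatMap fun _ => [.moveS .left]) ::
    (is.flatMap (tapePieces R chk) ++ inputPieces R i₀)

theorem flatten_replicate_flatMap {α β : Type*} (T : ℕ) (R : List α) (f : α → List β) :
    (List.replicate T (R.flatMap f)).flatten = (List.replicate T R).flatten.flatMap f := by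
  induction T with
  | zero => rfl
  | succ T ih => simp [List.replicate_succ, ih]

theorem flatten_replicate_reverse {α : Type*} (T : ℕ) (R : List α) :
    (List.replicate T R.reverse).flatten = (List.replicate T R).flatten.reverse := by
  simp [List.reverse_flatten]

theorem piecesProg_cons (p : Piece) (ps : List Piece) (T : ℕ) (x : List Bool) :
    piecesProg (p :: ps) T x = p.prog T x ++ piecesProg ps T x := rfl

theorem piecesProg_append (ps ps' : List Piece) (T : ℕ) (x : List Bool) :
    piecesProg (ps ++ ps') T x = piecesProg ps T x ++ piecesProg ps' T x := by
  simp [piecesProg]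

theorem piecesProg_nil (T : ℕ) (x : List Bool) : piecesProg [] T x = [] := rfl

variable {T : ℕ} {x : List Bool} {R : List (Rule ι)} {al : List (Rule ι × Bool)} {q : List Bool}
  {u : SLState}

theorem mem_execs_check (l : List (Option Bool)) (c : Option (Option Bool))
    (W : Tape (Option Bool)) :
    u ∈ execs A (.mark true :: (c.toList.map .check ++ [.mark false])) ⟨Tape.mk₂ l [], W, q⟩ ↔
      (∀ s ∈ c, W.head = s) ∧ u = ⟨Tape.mk₂ l [], W, q⟩ := by
  rcases c with _ | c <;>
    simp [execs, Instr.exec, mk₂_write_nil, mk₂_write, markSym, mk₂_none_right, mk₂_head, and_assoc]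

/-- These pieces act as a pure test: they leave the state as it was, so that the same work tape can
next play the role of another tape. -/
theorem mem_execs_tapePieces (hal : al.map (·.1) = (List.replicate T R).flatten)
    (chk : ι → Option (Option Bool)) (i : ι) (W : Tape (Option Bool)) :
    u ∈ execs A (piecesProg (tapePieces R chk i) T x) ⟨Tape.mk₂ [] (marks al), W, q⟩ ↔
      (∃ W', tapeRun i (chosen al) W = some W' ∧ ∀ s ∈ chk i, W'.head = s) ∧
        u = ⟨Tape.mk₂ [] (marks al), W, q⟩ := by
  simp only [tapePieces, piecesProg_cons, piecesProg_nil, List.append_nil, Piece.prog,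
    mem_execs_append, flatten_replicate_flatMap, flatten_replicate_reverse, ← hal]
  have hf := fun v => mem_execs_forward (A := A) i al [] [] W q v
  have hb := fun (W' : Tape (Option Bool)) (h : tapeRun i (chosen al) W = some W') v =>
    mem_execs_backward (A := A) i al [] [] h q v
  simp only [List.append_nil] at hf hb
  simp only [hf]
  constructor
  · rintro ⟨_, ⟨W', hW', rfl⟩, t, ht, h⟩
    obtain ⟨h1, rfl⟩ := (mem_execs_check _ _ _).1 ht
    exact ⟨⟨W', hW', h1⟩, (hb _ hW' _).1 h⟩
  · rintro ⟨⟨W', hW', h1⟩, rfl⟩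
    exact ⟨_, ⟨W', hW', rfl⟩, _, (mem_execs_check _ _ _).2 ⟨h1, rfl⟩, (hb _ hW' _).2 rfl⟩

theorem mem_execs_flatMap_tapePieces (hal : al.map (·.1) = (List.replicate T R).flatten)
    (chk : ι → Option (Option Bool)) (is : List ι) (W : Tape (Option Bool)) :
    u ∈ execs A (piecesProg (is.flatMap (tapePieces R chk)) T x)
        ⟨Tape.mk₂ [] (marks al), W, q⟩ ↔
      (∀ i ∈ is, ∃ W', tapeRun i (chosen al) W = some W' ∧ ∀ s ∈ chk i, W'.head = s) ∧
        u = ⟨Tape.mk₂ [] (marks al), W, q⟩ := by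
  induction is with
  | nil => simp [piecesProg, execs]
  | cons i is ih =>
    simp only [List.flatMap_cons, piecesProg_append, mem_execs_append, mem_execs_tapePieces hal,
      List.forall_mem_cons]
    constructor
    · rintro ⟨_, ⟨h, rfl⟩, h'⟩
      exact ⟨⟨h, (ih.1 h').1⟩, (ih.1 h').2⟩
    · rintro ⟨⟨h, h'⟩, hu⟩
      exact ⟨_, ⟨h, rfl⟩, ih.2 ⟨h', hu⟩⟩

theorem mem_execs_writeInput (x : List Bool) (l : List (Option Bool)) {S : Tape (Option Bool)}
    (hS : S.head = some true) :
    u ∈ execs A (x.flatMap fun b => [.write (some b), .moveW .right]) ⟨S, Tape.mk₂ l [], q⟩ ↔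
      u = ⟨S, Tape.mk₂ ((x.map some).reverse ++ l) [], q⟩ := by
  induction x generalizing l with
  | nil => simp [execs]
  | cons b x ih =>
    simp [execs, Instr.exec, hS, mk₂_write_nil, mk₂_move_right, ih]

theorem mem_execs_rewindInput (x : List Bool) (r : List (Option Bool)) {S : Tape (Option Bool)}
    (hS : S.head = some true) :
    u ∈ execs A (x.flatMap fun _ => [.moveW .left])
        ⟨S, Tape.mk₂ ((x.map some).reverse) r, q⟩ ↔
      u = ⟨S, Tape.mk₂ [] (x.map some ++ r), q⟩ := by
  induction x using List.reverseRecOn generalizing r with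
  | nil => simp [execs]
  | append_singleton x b ih =>
    have h : ∀ x : List Bool, (x ++ [b]).flatMap (fun _ => [Instr.moveW .left]) =
        .moveW .left :: x.flatMap fun _ => [Instr.moveW .left] := by
      intro x
      induction x with
      | nil => rfl
      | cons _ _ ih => simpa using ih
    rw [h]
    simp [execs, Instr.exec, hS, mk₂_move_left, ih]

theorem execs_inputPieces_nonempty (hal : al.map (·.1) = (List.replicate T R).flatten) (i : ι) :
    (execs A (piecesProg (inputPieces R i) T x)
      ⟨Tape.mk₂ [] (marks al), Tape.mk₁ [], q⟩).Nonempty ↔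
      ∃ W', tapeRun i (chosen al) (Tape.mk₁ (x.map some)) = some W' := by
  have hf := fun W q v => mem_execs_forward (A := A) i al [] [] W q v
  simp only [List.append_nil] at hf
  simp only [inputPieces, piecesProg_cons, piecesProg_nil, List.append_nil, Piece.prog,
    Set.Nonempty, mem_execs_append, flatten_replicate_flatMap, ← hal, execs,
    Instr.exec, Set.mem_singleton_iff, exists_eq_left, Set.mem_ofPred_eq, mk₂_nil_move_left,
    mk₂_write, mk₁_eq_mk₂, markSym_true, markSym_false, mk₂_head, mk₂_move_right,
    mem_execs_writeInput, mem_execs_rewindInput, mk₂_none_left, hf]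
  constructor
  · rintro ⟨_, W', h, rfl⟩
    exact ⟨W', h⟩
  · rintro ⟨W', h⟩
    exact ⟨_, W', h, rfl⟩

/-- For a fixed list of chosen rules, applicability is a conjunction of independent conditions, one
for each tape and one for the query tape; this is why a single work tape is enough. -/
theorem execs_rulesPieces_nonempty (R : List (Rule ι)) (is : List ι) (i₀ : ι)
    (chk : ι → Option (Option Bool)) (T : ℕ) (x : List Bool) :
    (execs A (piecesProg (rulesPieces R is i₀ chk) T x) .init).Nonempty ↔
      ∃ al : List (Rule ι × Bool), al.map (·.1) = (List.replicate T R).flatten ∧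
        (∃ q, queryRun A (chosen al) [] = some q) ∧
        (∀ i ∈ is, ∃ W', tapeRun i (chosen al) (Tape.mk₁ []) = some W' ∧
          ∀ s ∈ chk i, W'.head = s) ∧
        ∃ W', tapeRun i₀ (chosen al) (Tape.mk₁ (x.map some)) = some W' := by
  have hl : ∀ (rs : List (Rule ι)),
      rs.flatMap (fun _ => [Instr.moveS .left]) = List.replicate rs.length (.moveS .left) := by
    intro rs
    induction rs with
    | nil => rfl
    | cons _ _ ih => simp [ih, List.replicate_succ]
  have hs := fun rs v => mem_execs_select (A := A) (ι := ι) rs [] [] v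
  have hm := fun (xs : List (Option Bool)) W q n hn v =>
    mem_execs_moveS_left (A := A) xs [] [] W q n hn v
  simp only [List.append_nil] at hs hm
  have hinit : SLState.init = ⟨Tape.mk₂ [] [], Tape.mk₁ [], []⟩ := rfl
  simp only [Set.Nonempty, rulesPieces, piecesProg_cons, piecesProg_append, mem_execs_append,
    Piece.prog, flatten_replicate_flatMap, hinit, hs]
  constructor
  · rintro ⟨u, _, ⟨al, hal, q', hq', rfl⟩, v, hv, w, hw, hu⟩
    rw [hl, hm _ _ _ _ (by simp [marks, ← hal])] at hv
    subst hv
    rw [mem_execs_flatMap_tapePieces hal] at hw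
    obtain ⟨hw, rfl⟩ := hw
    exact ⟨al, hal, ⟨q', hq'⟩, hw, (execs_inputPieces_nonempty hal _).1 ⟨u, hu⟩⟩
  · rintro ⟨al, hal, ⟨q', hq'⟩, hw, h⟩
    obtain ⟨u, hu⟩ := (execs_inputPieces_nonempty (A := A) (q := q') hal _).2 h
    refine ⟨u, _, ⟨al, hal, q', hq', rfl⟩, ?_⟩
    rw [hl]
    exact ⟨_, (hm _ _ _ _ (by simp [marks, ← hal]) _).2 rfl, _,
      (mem_execs_flatMap_tapePieces hal _ _ _).2 ⟨hw, rfl⟩, hu⟩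

theorem mem_of_mem_chosen {r : Rule ι} (hal : al.map (·.1) = (List.replicate T R).flatten)
    (hr : r ∈ chosen al) : r ∈ R := by
  have h : r ∈ al.map (·.1) := by
    simp only [chosen, List.mem_map, List.mem_filter] at hr ⊢
    obtain ⟨a, ⟨ha, -⟩, rfl⟩ := hr
    exact ⟨a, ha, rfl⟩
  rw [hal, List.mem_flatten] at h
  obtain ⟨l, hl, hr⟩ := h
  rwa [List.eq_of_mem_replicate hl] at hr

theorem exists_chosen_none (R : List (Rule ι)) :
    ∃ al : List (Rule ι × Bool), al.map (·.1) = R ∧ chosen al = [] :=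
  ⟨R.map fun r => (r, false), by simp [Function.comp_def], by simp [chosen]⟩

theorem chosen_append (al al' : List (Rule ι × Bool)) :
    chosen (al ++ al') = chosen al ++ chosen al' := by
  simp [chosen]

/-- One rule is selected in each of the first `rs.length` copies of `R`, and none in the remaining
copies. -/
theorem exists_chosen_eq {T : ℕ} {R rs : List (Rule ι)} (hrs : ∀ r ∈ rs, r ∈ R)
    (hT : rs.length ≤ T) : ∃ al : List (Rule ι × Bool),
      al.map (·.1) = (List.replicate T R).flatten ∧ chosen al = rs := by
  induction T generalizing rs with
  | zero =>
    obtain rfl : rs = [] := List.length_eq_zero_iff.1 (by omega)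
    exact ⟨[], rfl, rfl⟩
  | succ T ih =>
    cases rs with
    | nil =>
      obtain ⟨al, h1, h2⟩ := exists_chosen_none R
      obtain ⟨al', h3, h4⟩ := ih (rs := []) (by simp) (by simp)
      exact ⟨al ++ al', by simp [h1, h3, List.replicate_succ], by simp [chosen_append, h2, h4]⟩
    | cons r rs =>
      obtain ⟨R₁, R₂, hR⟩ := List.append_of_mem (hrs r (by simp))
      obtain ⟨al₁, h1, h2⟩ := exists_chosen_none R₁
      obtain ⟨al₂, h3, h4⟩ := exists_chosen_none R₂
      obtain ⟨al', h5, h6⟩ := ih (rs := rs) (fun s hs => hrs s (by simp [hs]))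
        (by simpa using hT)
      refine ⟨al₁ ++ (r, true) :: al₂ ++ al', ?_, ?_⟩
      · simp [h1, h3, h5, List.replicate_succ, hR]
      · rw [chosen_append, chosen_append, chosen_cons, h2, h4, h6]
        rfl

end

/-! ### Accepting computations as lists of rules -/

section
variable {ι : Type} {A : Set (List Bool)}

/-- A list of rules is applicable to the tapes `V` and the query string `q`, and `some true` is
scanned at the end on tape `j`. -/
def Applicable (A : Set (List Bool)) (j : ι) (rs : List (Rule ι)) (V : ι → Tape (Option Bool))
    (q : List Bool) : Prop :=
  (∃ q', queryRun A rs q = some q') ∧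
    ∀ i, ∃ W, tapeRun i rs (V i) = some W ∧ (i = j → W.head = some true)

theorem applicable_nil {j : ι} {V : ι → Tape (Option Bool)} {q : List Bool} :
    Applicable A j [] V q ↔ (V j).head = some true := by
  simp [Applicable, queryRun, tapeRun]

open Classical in
theorem applicable_cons {j : ι} {r : Rule ι} {rs : List (Rule ι)} {V : ι → Tape (Option Bool)}
    {q : List Bool} : Applicable A j (r :: rs) V q ↔ (∀ i, (V i).head = r.old i) ∧
      (∀ b ∈ r.answer, decide (q ∈ A) = b) ∧
      Applicable A j rs (fun i => actTape (r.new i) (r.move i) (V i))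
        (if r.answer = none then q ++ r.ask.toList else []) := by
  have h : (∀ i, ∃ W, tapeRun i (r :: rs) (V i) = some W ∧ (i = j → W.head = some true)) ↔
      (∀ i, (V i).head = r.old i) ∧
      ∀ i, ∃ W, tapeRun i rs (actTape (r.new i) (r.move i) (V i)) = some W ∧
        (i = j → W.head = some true) := by
    rw [← forall_and]
    refine forall_congr' fun i => ?_
    by_cases hi : (V i).head = r.old i <;> simp [tapeRun, hi]
  rw [Applicable, h, Applicable]
  rcases hr : r.answer with _ | b
  · simp [queryRun, hr]
    tauto
  · by_cases hq : decide (q ∈ A) = b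
    · simp only [queryRun, hr, hq]
      simp
      tauto
    · simp only [queryRun, hr, hq]
      simp
      tauto

end

section
variable (N : OracleNTM)

/-- The tapes of a machine, and for every state (and an additional final state `none`) a tape whose
single symbol is determined by the current state. -/
abbrev TapeIdx : Type := Fin (N.k + 1) ⊕ Option N.Q

variable {N}

open Classical in
/-- The symbol on the tape of state `j` when the current state is `q`; it is blank for the start
state. -/
noncomputable def stateSym (q j : Option N.Q) : Option Bool :=
  if q = j ↔ some N.start = j then none else some true

/-- The symbols form the indicator of the current state, toggled at the start state. Toggling keeps
distinct states distinct and makes all state tapes blank at the start, as the program requires. -/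
theorem stateSym_injective {q q' : Option N.Q} (h : stateSym q = stateSym q') : q = q' := by
  have h1 := congrFun h q
  have h2 := congrFun h q'
  simp only [stateSym] at h1 h2
  by_contra hq
  by_cases h3 : some N.start = q <;> by_cases h4 : some N.start = q' <;>
    simp_all [Ne.symm hq, eq_comm]

theorem stateSym_start : stateSym (some N.start) = fun _ => none := by
  funext j
  simp [stateSym]

theorem stateSym_final (q : Option N.Q) : stateSym q none = some true ↔ q = none := by
  by_cases h : q = none <;> simp [stateSym, h]

/-- The rule for passing from state `q` to state `q'`. -/
noncomputable def stateRule (q q' : Option N.Q) (s w : Fin (N.k + 1) → Option Bool)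
    (m : Fin (N.k + 1) → Option Dir) (ask answer : Option Bool) : Rule (TapeIdx N) :=
  ⟨Sum.elim s (stateSym q), Sum.elim w (stateSym q'), Sum.elim m fun _ => none, ask, answer⟩

variable (N) in
/-- The rules of a machine: ordinary steps, queries, and the passage to the final state when the
machine halts in its accepting state. -/
def machineRules : Set (Rule (TapeIdx N)) :=
  {r | (∃ q s, q ≠ N.query ∧ ∃ a ∈ N.δ q s,
      r = stateRule (some q) (some a.next) s a.write a.move a.ask none) ∨
    (∃ s b, r = stateRule (some N.query) (some (if b then N.yes else N.no)) s s (fun _ => none)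
      none (some b)) ∨
    (N.accept ≠ N.query ∧ ∃ s, N.δ N.accept s = ∅ ∧
      r = stateRule (some N.accept) none s s (fun _ => none) none none)}

/-- The tapes that represent a configuration. -/
noncomputable def cfgTapes (q : Option N.Q) (t : Fin (N.k + 1) → Tape (Option Bool)) :
    TapeIdx N → Tape (Option Bool) :=
  Sum.elim t fun j => Tape.mk₂ [] [stateSym q j]

variable {A : Set (List Bool)}

/-- By injectivity of `stateSym`, the scanned symbols on the state tapes agree with the rule exactly
if the current state is the rule's old state. So successive rules fit together in their states
whenever they do so on every tape. -/
theorem applicable_stateRule {q q' p : Option N.Q} {s w : Fin (N.k + 1) → Option Bool}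
    {m : Fin (N.k + 1) → Option Dir} {ask answer : Option Bool} {rs : List (Rule (TapeIdx N))}
    {t : Fin (N.k + 1) → Tape (Option Bool)} {z : List Bool} :
    Applicable A (Sum.inr none) (stateRule q q' s w m ask answer :: rs) (cfgTapes p t) z ↔
      (p = q ∧ ∀ i, (t i).head = s i) ∧
      (∀ b ∈ answer, (open Classical in decide (z ∈ A)) = b) ∧
      Applicable A (Sum.inr none) rs (cfgTapes q' fun i => actTape (w i) (m i) (t i))
        (if answer = none then z ++ ask.toList else []) := by
  have h1 : (∀ i, (cfgTapes p t i).head = (stateRule q q' s w m ask answer).old i) ↔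
      p = q ∧ ∀ i, (t i).head = s i := by
    simp only [Sum.forall, cfgTapes, stateRule, Sum.elim_inl, Sum.elim_inr, mk₂_head]
    rw [and_comm, ← funext_iff]
    exact and_congr_left fun _ => ⟨stateSym_injective, fun h => h ▸ rfl⟩
  have h2 : (fun i => actTape ((stateRule q q' s w m ask answer).new i)
      ((stateRule q q' s w m ask answer).move i) (cfgTapes p t i)) =
      cfgTapes q' fun i => actTape (w i) (m i) (t i) := by
    funext i
    rcases i with i | j
    · rfl
    · simp [cfgTapes, stateRule, actTape, mk₂_write]
  rw [applicable_cons, h1, h2]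
  rfl

theorem cfg_ext {M : OracleNTM} {c d : M.Cfg} (h1 : c.state = d.state) (h2 : c.tape = d.tape)
    (h3 : c.queryTape = d.queryTape) : c = d := by
  cases c
  cases d
  simp_all

theorem acceptsFrom_of_applicable (rs : List (Rule (TapeIdx N)))
    (hrs : ∀ r ∈ rs, r ∈ machineRules N) (c : N.Cfg)
    (h : Applicable A (Sum.inr none) rs (cfgTapes (some c.state) c.tape) c.queryTape) :
    N.AcceptsFrom A c := by
  classical
  induction rs generalizing c with
  -- Without any rule the final state `none` has not been reached.
  | nil => simp [applicable_nil, cfgTapes, mk₂_head, stateSym_final] at h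
  | cons r rs ih =>
    have hrs' : ∀ r ∈ rs, r ∈ machineRules N := fun r hr => hrs r (List.mem_cons_of_mem _ hr)
    rcases hrs r List.mem_cons_self with ⟨q, s, hq, a, ha, rfl⟩ | ⟨s, b, rfl⟩ | ⟨hq, s, hs, rfl⟩
    · obtain ⟨⟨h1, h2⟩, -, h3⟩ := applicable_stateRule.1 h
      obtain rfl := Option.some.inj h1
      obtain rfl : (fun i => (c.tape i).head) = s := funext h2
      exact OracleNTM.acceptsFrom_iff.2 (Or.inr ⟨N.act c a, Or.inr ⟨hq, a, ha, rfl⟩,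
        ih hrs' _ h3⟩)
    · obtain ⟨⟨h1, h2⟩, hb, h3⟩ := applicable_stateRule.1 h
      have h1 := Option.some.inj h1
      obtain rfl : (fun i => (c.tape i).head) = s := funext h2
      have h4 : N.answer A c = ⟨if b then N.yes else N.no, c.tape, []⟩ := by
        have hb := hb b rfl
        simp only [OracleNTM.answer, ← hb, decide_eq_true_eq]
      refine OracleNTM.acceptsFrom_iff.2 (Or.inr ⟨N.answer A c, Or.inl ⟨h1, rfl⟩, ih hrs' _ ?_⟩)
      rw [h4]
      simpa [actTape, Tape.write_self] using h3
    · obtain ⟨⟨h1, h2⟩, -, -⟩ := applicable_stateRule.1 h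
      have h1 := Option.some.inj h1
      obtain rfl : (fun i => (c.tape i).head) = s := funext h2
      refine OracleNTM.acceptsFrom_iff.2 (Or.inl ⟨fun d hd => ?_, h1⟩)
      rcases hd with ⟨hd, -⟩ | ⟨-, a, ha, -⟩
      · exact hq (h1 ▸ hd)
      · rw [h1, hs] at ha
        exact ha

/-- The rule beyond the `n` steps is the passage to the final state `none`, which certifies that the
machine has halted and accepts. -/
theorem exists_applicable (n : ℕ) (c c' : N.Cfg) (hc : c' ∈ N.after A c n)
    (hh : ∀ d, ¬ N.Step A c' d) (ha : c'.state = N.accept) :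
    ∃ rs : List (Rule (TapeIdx N)), (∀ r ∈ rs, r ∈ machineRules N) ∧ rs.length = n + 1 ∧
      Applicable A (Sum.inr none) rs (cfgTapes (some c.state) c.tape) c.queryTape := by
  classical
  induction n generalizing c with
  | zero =>
    obtain rfl : c' = c := hc
    -- A machine in its query state never halts, since the question is always answered.
    have hq : c'.state ≠ N.query := fun h => hh _ (Or.inl ⟨h, rfl⟩)
    refine ⟨[stateRule (some N.accept) none (fun i => (c'.tape i).head)
      (fun i => (c'.tape i).head) (fun _ => none) none none], ?_, rfl, ?_⟩
    · intro r hr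
      refine Or.inr (Or.inr ⟨ha ▸ hq, fun i => (c'.tape i).head, ?_, List.mem_singleton.1 hr⟩)
      ext a
      exact iff_of_false (fun h => hh _ (Or.inr ⟨hq, a, ha ▸ h, rfl⟩)) (Set.notMem_empty _)
    · refine applicable_stateRule.2 ⟨⟨by rw [ha], fun _ => rfl⟩, by simp, ?_⟩
      simp [applicable_nil, cfgTapes, mk₂_head, stateSym_final]
  | succ n ih =>
    obtain ⟨d, hd, hc'⟩ := OracleNTM.mem_after_succ'.1 hc
    obtain ⟨rs, hrs, hlen, happ⟩ := ih d hc'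
    rcases hd with ⟨hq, rfl⟩ | ⟨hq, a, ha', rfl⟩
    · refine ⟨stateRule (some N.query) (some (if decide (c.queryTape ∈ A) then N.yes else N.no))
        (fun i => (c.tape i).head) (fun i => (c.tape i).head) (fun _ => none) none
        (some (decide (c.queryTape ∈ A))) :: rs, ?_, by simp [hlen], ?_⟩
      · intro r hr
        rcases List.mem_cons.1 hr with rfl | hr
        · exact Or.inr (Or.inl ⟨_, _, rfl⟩)
        · exact hrs r hr
      · refine applicable_stateRule.2 ⟨⟨by rw [hq], fun _ => rfl⟩, by simp, ?_⟩
        simpa [actTape, Tape.write_self, OracleNTM.answer] using happ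
    · refine ⟨stateRule (some c.state) (some a.next) (fun i => (c.tape i).head) a.write a.move
        a.ask none :: rs, ?_, by simp [hlen], ?_⟩
      · intro r hr
        rcases List.mem_cons.1 hr with rfl | hr
        · exact Or.inl ⟨_, _, hq, a, ha', rfl⟩
        · exact hrs r hr
      · exact applicable_stateRule.2 ⟨⟨rfl, fun _ => rfl⟩, by simp, happ⟩

open Classical in
theorem cfgTapes_init (x : List Bool) (i : TapeIdx N) :
    cfgTapes (some (N.init x).state) (N.init x).tape i =
      if i = Sum.inl 0 then Tape.mk₁ (x.map some) else Tape.mk₁ [] := by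
  rcases i with i | j
  · simp [cfgTapes, OracleNTM.init]
  · simp only [cfgTapes, OracleNTM.init, stateSym_start, Sum.elim_inr, mk₂_none_right]
    rfl

/-- The evaluator solves a complete problem: every language in `NP^A` is reduced to its language by
a straight-line program that consists of a fixed number of building blocks. -/
theorem exists_pieces (N : OracleNTM) : ∃ ps : List Piece, ∀ (A : Set (List Bool)) (d : ℕ),
    N.PolyTime A d → ∀ x : List Bool, x ∈ N.language A ↔
      progCode (piecesProg ps ((x.length + 2) ^ (d + 1)) x) ∈ evaluator.language A := by
  classical
  have := N.finite
  have := Fintype.ofFinite N.Q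
  let R := (machineRules N).toFinite.toFinset.toList
  have hR : ∀ r, r ∈ R ↔ r ∈ machineRules N := by simp [R]
  let is := ((Finset.univ : Finset (TapeIdx N)).erase (Sum.inl 0)).toList
  have his : ∀ i, i ∈ is ↔ i ≠ Sum.inl 0 := by simp [is]
  refine ⟨rulesPieces R is (Sum.inl 0)
    -- The only final check is on the tape of the final state, which must carry its mark.
    (fun i => if i = Sum.inr none then some (some true) else none), fun A d hN x => ?_⟩
  rw [progCode_mem_language, execs_rulesPieces_nonempty]
  change N.Accepts A x ↔ _
  rw [OracleNTM.accepts_iff]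
  have key : ∀ rs : List (Rule (TapeIdx N)),
      Applicable A (Sum.inr none) rs (cfgTapes (some (N.init x).state) (N.init x).tape) [] ↔
        (∃ q, queryRun A rs [] = some q) ∧
        (∀ i ∈ is, ∃ W', tapeRun i rs (Tape.mk₁ []) = some W' ∧
          ∀ s ∈ (if i = Sum.inr none then some (some true) else none), W'.head = s) ∧
        ∃ W', tapeRun (Sum.inl 0) rs (Tape.mk₁ (x.map some)) = some W' := by
    intro rs
    simp only [Applicable, cfgTapes_init, his]
    refine and_congr_right fun _ => ⟨fun h => ⟨fun i hi => ?_, ?_⟩, fun ⟨h1, h2⟩ i => ?_⟩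
    · obtain ⟨W, hW, hW'⟩ := h i
      rw [if_neg hi] at hW
      refine ⟨W, hW, fun s hs => ?_⟩
      split_ifs at hs with hi'
      · rw [hW' hi', Option.some.inj hs]
      · simp at hs
    · obtain ⟨W, hW, -⟩ := h (Sum.inl 0)
      exact ⟨W, by simpa using hW⟩
    · by_cases hi : i = Sum.inl 0
      · subst hi
        obtain ⟨W, hW⟩ := h2
        exact ⟨W, by simpa using hW, by simp⟩
      · obtain ⟨W, hW, hW'⟩ := h1 i hi
        exact ⟨W, by simpa [hi] using hW, fun h => hW' _ (by simp [h])⟩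
  constructor
  · rintro ⟨n, c', hc', hh, ha⟩
    have hn : n ≤ x.length ^ d + d := by
      by_contra hlt
      have := OracleNTM.after_eq_empty_of_le (n := n) (by omega)
        ((OracleNTM.haltsWithin_iff x _).1 (hN x))
      rw [this] at hc'
      exact hc'
    obtain ⟨rs, hrs, hlen, happ⟩ := exists_applicable n _ c' hc' hh ha
    -- There are at most `|x| ^ d + d + 1` rules. Since `d + 1 ≤ 2 ^ d`, this is at most `2 * (|x| +
    -- 2) ^ d`, and one more factor `|x| + 2` absorbs the 2.
    have hT : rs.length ≤ (x.length + 2) ^ (d + 1) := by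
      have h1 : x.length ^ d ≤ (x.length + 2) ^ d := Nat.pow_le_pow_left (by omega) d
      have h2 : 2 ^ d ≤ (x.length + 2) ^ d := Nat.pow_le_pow_left (by omega) d
      have h3 : d < 2 ^ d := Nat.lt_two_pow_self
      have h4 : (x.length + 2) ^ d * 2 ≤ (x.length + 2) ^ d * (x.length + 2) :=
        Nat.mul_le_mul_left _ (by omega)
      rw [pow_succ]
      omega
    obtain ⟨al, hal, hch⟩ := exists_chosen_eq (R := R) (fun r hr => (hR r).2 (hrs r hr)) hT
    exact ⟨al, hal, hch ▸ (key rs).1 happ⟩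
  -- Soundness does not depend on the number of rounds: any applicable list of rules traces an
  -- accepting computation.
  · rintro ⟨al, hal, h⟩
    exact acceptsFrom_of_applicable (chosen al)
      (fun r hr => (hR r).1 (mem_of_mem_chosen hal hr)) _ ((key _).2 h)

end

/-! ### Transducers and their combinators -/

/-- A deterministic device without oracle that works on the tapes `ι`, as a part of a machine. The
state `none` stands for the exit. -/
structure Transducer (ι : Type) where
  St : Type
  finite : Finite St
  start : St
  step : St → (ι → Option Bool) → Option St × (ι → Option Bool) × (ι → Option Dir)

namespace Transducer

variable {ι : Type}

/-- `R.Run s V V' n`: from state `s` and tapes `V`, the exit is reached with the tapes `V'` after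
`n` steps. -/
inductive Run (R : Transducer ι) :
    Option R.St → (ι → Tape (Option Bool)) → (ι → Tape (Option Bool)) → ℕ → Prop
  | exit (V) : Run R none V V 0
  | step {s V V' n} (h : Run R (R.step s fun i => (V i).head).1
      (fun i => actTape ((R.step s fun i => (V i).head).2.1 i)
        ((R.step s fun i => (V i).head).2.2 i) (V i)) V' n) : Run R (some s) V V' (n + 1)

/-- A run from the start state to the exit. -/
def Runs (R : Transducer ι) (V V' : ι → Tape (Option Bool)) (n : ℕ) : Prop :=
  R.Run (some R.start) V V' n

/-- A single step. -/
def prim (f : (ι → Option Bool) → (ι → Option Bool) × (ι → Option Dir)) : Transducer ι where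
  St := Unit
  finite := inferInstance
  start := ()
  step _ h := (none, f h)

/-- Composition. -/
def seq (R R' : Transducer ι) : Transducer ι where
  St := R.St ⊕ R'.St
  finite := have := R.finite; have := R'.finite; inferInstance
  start := .inl R.start
  step
    -- The exit of the first device is identified with the start of the second, so running times
    -- simply add up.
    | .inl s, h => (some (((R.step s h).1.map .inl).getD (.inr R'.start)), (R.step s h).2)
    | .inr s, h => ((R'.step s h).1.map .inr, (R'.step s h).2)

/-- Iteration as long as the symbol scanned on tape `i` is not blank. -/
def iter (i : ι) (R : Transducer ι) : Transducer ι where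
  St := Option R.St
  finite := have := R.finite; inferInstance
  start := none
  step
    | none, h => (if h i = none then none else some (some R.start), h, fun _ => none)
    | some s, h => (some (R.step s h).1, (R.step s h).2)

/-- Case distinction by the bit scanned on tape `i`. -/
def cond (i : ι) (R : Bool → Transducer ι) : Transducer ι where
  St := Option ((R true).St ⊕ (R false).St)
  finite := have := (R true).finite; have := (R false).finite; inferInstance
  start := none
  step
    | none, h => (some (some (if h i = some true then .inl (R true).start
        else .inr (R false).start)), h, fun _ => none)
    | some (.inl s), h => (((R true).step s h).1.map (some ∘ .inl), ((R true).step s h).2)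
    | some (.inr s), h => (((R false).step s h).1.map (some ∘ .inr), ((R false).step s h).2)

section

variable {R R' : Transducer ι} {V V' V'' : ι → Tape (Option Bool)} {m n : ℕ} {i : ι}

theorem Runs.of_eq (h : R.Runs V V' m) (hV : V' = V'') (hm : m = n) : R.Runs V V'' n := by
  rwa [← hV, ← hm]

theorem Run.seq_right {s : Option R'.St} (h : R'.Run s V V' n) :
    (seq R R').Run (s.map .inr) V V' n := by
  induction h with
  | exit => exact .exit _
  | step _ ih => exact .step ih

theorem Run.seq_left {s : Option R.St} (h : R.Run s V V' m) (h' : R'.Runs V' V'' n) :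
    (seq R R').Run (some ((s.map .inl).getD (.inr R'.start))) V V'' (m + n) := by
  induction h with
  | exit => rw [Nat.zero_add]; exact h'.seq_right
  | step _ ih => rw [Nat.add_right_comm]; exact .step (ih h')

theorem Runs.seq (h : R.Runs V V' m) (h' : R'.Runs V' V'' n) :
    (R.seq R').Runs V V'' (m + n) :=
  Run.seq_left h h'

theorem runs_iter_exit (h : (V i).head = none) : (R.iter i).Runs V V 1 := by
  have h1 : (R.iter i).Run none V V 0 := .exit _
  refine .step ?_
  simpa only [Transducer.iter, h, if_pos, actTape, Tape.write_self] using h1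

theorem Run.iter_body {s : Option R.St} (h : R.Run s V V' m) (h' : (R.iter i).Runs V' V'' n) :
    (R.iter i).Run (some s) V V'' (m + n) := by
  induction h with
  | exit => rw [Nat.zero_add]; exact h'
  | step _ ih => rw [Nat.add_right_comm]; exact .step (ih h')

theorem Runs.iter (hi : (V i).head ≠ none) (h : R.Runs V V' m)
    (h' : (R.iter i).Runs V' V'' n) : (R.iter i).Runs V V'' (m + n + 1) := by
  have h1 := Run.iter_body h h'
  refine .step ?_
  simpa only [Transducer.iter, hi, if_neg, not_false_eq_true, actTape, Tape.write_self] using h1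

theorem Run.cond_true {R : Bool → Transducer ι} {s : Option (R true).St}
    (h : (R true).Run s V V' n) : (cond i R).Run (s.map (some ∘ .inl)) V V' n := by
  induction h with
  | exit => exact .exit _
  | step _ ih => exact .step ih

theorem Run.cond_false {R : Bool → Transducer ι} {s : Option (R false).St}
    (h : (R false).Run s V V' n) : (cond i R).Run (s.map (some ∘ .inr)) V V' n := by
  induction h with
  | exit => exact .exit _
  | step _ ih => exact .step ih

theorem Runs.cond {R : Bool → Transducer ι} {b : Bool} (hb : (V i).head = some b)
    (h : (R b).Runs V V' n) : (cond i R).Runs V V' (n + 1) := by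
  refine .step ?_
  cases b
  · simpa [Transducer.cond, hb, actTape, Tape.write_self] using h.cond_false (i := i)
  · simpa [Transducer.cond, hb, actTape, Tape.write_self] using h.cond_true (i := i)

theorem runs_prim {f : (ι → Option Bool) → (ι → Option Bool) × (ι → Option Dir)}
    (h : ∀ i, V' i = actTape ((f fun i => (V i).head).1 i) ((f fun i => (V i).head).2 i) (V i)) :
    (prim f).Runs V V' 1 := by
  rw [funext h]
  exact .step (.exit _)

end

section

variable [DecidableEq ι]

/-- Move the head of one tape. -/
def moveOn (i : ι) (d : Dir) : Transducer ι :=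
  prim fun h => (h, Function.update (fun _ => none) i (some d))

theorem runs_moveOn (i : ι) (d : Dir) (V : ι → Tape (Option Bool)) :
    (moveOn i d).Runs V (Function.update V i ((V i).move d)) 1 := by
  refine runs_prim fun j => ?_
  by_cases h : j = i
  · subst h
    simp [actTape]
  · simp [h, actTape]

/-- The result of writing a word on a tape. -/
def emitTape (w : List Bool) (T : Tape (Option Bool)) : Tape (Option Bool) :=
  w.foldl (fun T b => (T.write (some b)).move .right) T

theorem emitTape_append (w w' : List Bool) (T : Tape (Option Bool)) :
    emitTape (w ++ w') T = emitTape w' (emitTape w T) := by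
  simp [emitTape]

theorem emitTape_mk₂ (w : List Bool) (l : List (Option Bool)) :
    emitTape w (Tape.mk₂ l []) = Tape.mk₂ ((w.map some).reverse ++ l) [] := by
  induction w generalizing l with
  | nil => rfl
  | cons b w ih =>
    change emitTape w (((Tape.mk₂ l []).write (some b)).move .right) = _
    rw [mk₂_write_nil, mk₂_move_right, ih]
    simp

/-- Write a word on tape `o`. -/
def emitWord (o : ι) : List Bool → Transducer ι
  | [] => prim fun h => (h, fun _ => none)
  | b :: w => seq (prim fun h => (Function.update h o (some b),
      Function.update (fun _ => none) o (some .right))) (emitWord o w)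

theorem runs_emitWord (o : ι) (w : List Bool) (V : ι → Tape (Option Bool)) :
    (emitWord o w).Runs V (Function.update V o (emitTape w (V o))) (w.length + 1) := by
  induction w generalizing V with
  | nil =>
    refine runs_prim fun j => ?_
    simp [emitTape, actTape]
  | cons b w ih =>
    have h : (prim fun h => (Function.update h o (some b),
        Function.update (fun _ => none) o (some .right))).Runs V
        (Function.update V o (((V o).write (some b)).move .right)) 1 := by
      refine runs_prim fun j => ?_
      by_cases h : j = o
      · subst h
        simp [actTape]
      · simp [h, actTape]
    have h' := h.seq (ih _)
    rw [Function.update_idem, Function.update_self, Nat.add_comm] at h'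
    exact h'

/-- Move the head of tape `i` back to the first symbol. -/
def rewind (i : ι) : Transducer ι :=
  seq (moveOn i .left) (seq (iter i (moveOn i .left)) (moveOn i .right))

theorem runs_iter_moveOn_left (i : ι) (ys : List Bool) (b : Bool) (r : List (Option Bool))
    (V : ι → Tape (Option Bool))
    (hV : V i = Tape.mk₂ ((ys.map some).reverse) (some b :: r)) :
    (iter i (moveOn i .left)).Runs V
      (Function.update V i (Tape.mk₂ [] (none :: (ys.map some ++ some b :: r))))
      (2 * ys.length + 3) := by
  induction ys using List.reverseRecOn generalizing b r V with
  | nil =>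
    have h := runs_moveOn i .left V
    rw [hV, List.map_nil, List.reverse_nil, mk₂_nil_move_left] at h
    have h1 : (iter i (moveOn i .left)).Runs _ _ 1 :=
      runs_iter_exit (V := Function.update V i (Tape.mk₂ [] (none :: some b :: r)))
        (by rw [Function.update_self, mk₂_head])
    exact (Runs.iter (by simp [hV, mk₂_head]) h h1).of_eq rfl rfl
  | append_singleton ys c ih =>
    have h := runs_moveOn i .left V
    rw [hV, List.map_append, List.reverse_append, List.map_singleton, List.reverse_singleton,
      List.singleton_append, mk₂_move_left] at h
    have h' := h.iter (by simp [hV, mk₂_head])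
      (ih c (some b :: r) _ (Function.update_self ..))
    rw [Function.update_idem] at h'
    exact h'.of_eq (by simp) (by simp; omega)

/-- One step to the left from behind the word, two steps (test and move) for each symbol, a final
test on the blank in front, and one step to the right. For the empty word the excursion ends on the
same blank tape. -/
theorem runs_rewind (i : ι) (xs : List Bool) (V : ι → Tape (Option Bool))
    (hV : V i = Tape.mk₂ ((xs.map some).reverse) []) :
    (rewind i).Runs V (Function.update V i (Tape.mk₂ [] (xs.map some))) (2 * xs.length + 3) := by
  have h := runs_moveOn i .left V
  rw [hV] at h
  rcases List.eq_nil_or_concat xs with rfl | ⟨ys, b, rfl⟩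
  · rw [List.map_nil, List.reverse_nil, mk₂_nil_move_left] at h
    have h' := h.seq ((runs_iter_exit (i := i) (R := moveOn i .left)
      (by rw [Function.update_self, mk₂_head])).seq (runs_moveOn i .right _))
    rw [Function.update_idem, Function.update_self, mk₂_move_right, mk₂_none_left] at h'
    exact h'
  · rw [List.concat_eq_append] at hV h ⊢
    rw [List.map_append, List.reverse_append, List.map_singleton, List.reverse_singleton,
      List.singleton_append, mk₂_move_left] at h
    have h' := h.seq ((runs_iter_moveOn_left i ys b [] _ (Function.update_self ..)).seq
      (runs_moveOn i .right _))
    rw [Function.update_idem, Function.update_idem, Function.update_self, mk₂_move_right,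
      mk₂_none_left] at h'
    exact h'.of_eq (by simp) (by simp; omega)

/-- `R` writes the word `w` on tape `o` in at most `t` steps if the tapes in `D` are given by
`C`. -/
def Emits (R : Transducer ι) (o : ι) (D : Set ι) (C : ι → Tape (Option Bool)) (w : List Bool)
    (t : ℕ) : Prop :=
  ∀ V : ι → Tape (Option Bool), (∀ j ∈ D, V j = C j) →
    ∃ n ≤ t, R.Runs V (Function.update V o (emitTape w (V o))) n

/-- Repeat `R` for every symbol on tape `i`. -/
def loop (i : ι) (R : Transducer ι) : Transducer ι :=
  seq (iter i (seq R (moveOn i .right))) (rewind i)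

variable {R R' : Transducer ι} {o i : ι} {D : Set ι} {C : ι → Tape (Option Bool)}

theorem emits_emitWord (w : List Bool) : Emits (emitWord o w) o D C w (w.length + 1) :=
  fun V _ => ⟨_, le_rfl, runs_emitWord o w V⟩

theorem Emits.seq {w w' : List Bool} {t t' : ℕ} (ho : o ∉ D) (h : Emits R o D C w t)
    (h' : Emits R' o D C w' t') : Emits (R.seq R') o D C (w ++ w') (t + t') := by
  intro V hV
  obtain ⟨n, hn, hr⟩ := h V hV
  obtain ⟨n', hn', hr'⟩ := h' (Function.update V o (emitTape w (V o))) fun j hj => by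
    rw [Function.update_of_ne (by rintro rfl; exact ho hj), hV j hj]
  refine ⟨n + n', by omega, ?_⟩
  rw [emitTape_append]
  simpa using hr.seq hr'

/-- Rewinding tape `i` at the end leaves it unchanged, so that loops can be nested. Each symbol
costs the body, a test and a move (`t + 2`), and two more steps of the rewinding. -/
theorem emits_loop {f : Bool → List Bool} {t : ℕ} (hio : i ≠ o) (hi : i ∉ D) (ho : o ∉ D)
    (h : ∀ b V, (∀ j ∈ D, V j = C j) → (V i).head = some b →
      ∃ n ≤ t, R.Runs V (Function.update V o (emitTape (f b) (V o))) n)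
    {xs : List Bool} (hC : C i = Tape.mk₂ [] (xs.map some)) :
    Emits (R.loop i) o (insert i D) C (xs.flatMap f) (xs.length * (t + 4) + 4) := by
  -- The induction concerns the unread part `ys`, with an arbitrary part `l` already passed.
  have key : ∀ (ys : List Bool) (l : List (Option Bool)) (V : ι → Tape (Option Bool)),
      (∀ j ∈ D, V j = C j) → V i = Tape.mk₂ l (ys.map some) →
      ∃ n ≤ ys.length * (t + 2) + 1, (iter i (seq R (moveOn i .right))).Runs V
        (Function.update (Function.update V o (emitTape (ys.flatMap f) (V o))) i
          (Tape.mk₂ ((ys.map some).reverse ++ l) [])) n := by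
    intro ys
    induction ys with
    | nil =>
      intro l V hV hVi
      refine ⟨1, by simp, ?_⟩
      refine (runs_iter_exit (V := V) (i := i) ?_).of_eq ?_ rfl
      rotate_left
      · funext j
        by_cases hj : j = i
        · subst hj
          simp [hVi]
        · by_cases hj' : j = o
          · subst hj'
            simp [hj, emitTape]
          · simp [hj, hj']
      · rw [hVi]
        exact mk₂_head_nil l
    | cons b ys ih =>
      intro l V hV hVi
      have hb : (V i).head = some b := by rw [hVi]; exact mk₂_head _ _ _
      obtain ⟨n, hn, hr⟩ := h b V hV hb
      have hr1 := hr.seq (runs_moveOn i .right _)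
      rw [Function.update_of_ne hio, hVi, List.map_cons, mk₂_move_right] at hr1
      obtain ⟨n', hn', hr'⟩ := ih (some b :: l)
        (Function.update (Function.update V o (emitTape (f b) (V o))) i
          (Tape.mk₂ (some b :: l) (ys.map some))) (fun j hj => by
        rw [Function.update_of_ne (by rintro rfl; exact hi hj),
          Function.update_of_ne (by rintro rfl; exact ho hj), hV j hj]) (Function.update_self ..)
      refine ⟨_, ?_, (Runs.iter (by simp [hb]) hr1 hr').of_eq ?_ rfl⟩
      · simp only [List.length_cons]
        nlinarith
      · funext j
        by_cases hj : j = i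
        · subst hj
          simp
        · by_cases hj' : j = o
          · subst hj'
            simp [hj, emitTape_append]
          · simp [hj, hj']
  intro V hV
  obtain ⟨n, hn, hr⟩ := key xs [] V (fun j hj => hV j (Set.mem_insert_of_mem _ hj))
    ((hV i (Set.mem_insert _ _)).trans hC)
  rw [List.append_nil] at hr
  refine ⟨n + (2 * xs.length + 3), by nlinarith, ?_⟩
  refine (hr.seq (runs_rewind i xs _ (Function.update_self ..))).of_eq ?_ rfl
  funext j
  by_cases hj : j = i
  · subst hj
    simp [hio, hV _ (Set.mem_insert _ _), hC]
  · simp [hj]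

theorem Emits.mono {w : List Bool} {t : ℕ} {D' : Set ι} (h : Emits R o D C w t) (hD : D ⊆ D') :
    Emits R o D' C w t :=
  fun V hV => h V fun j hj => hV j (hD hj)

end

end Transducer

/-! ### Computing the codes of programs in polynomial time -/

theorem flatten_replicate_mul {α : Type*} (m n : ℕ) (w : List α) :
    (List.replicate m (List.replicate n w).flatten).flatten = (List.replicate (n * m) w).flatten := by
  induction m with
  | zero => simp
  | succ m ih =>
    rw [List.replicate_succ, List.flatten_cons, ih, ← List.flatten_append,
      List.replicate_append_replicate, Nat.mul_succ, Nat.add_comm]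

theorem flatMap_replicate {α β : Type*} (n : ℕ) (a : α) (f : α → List β) :
    (List.replicate n a).flatMap f = (List.replicate n (f a)).flatten := by
  induction n with
  | zero => rfl
  | succ n ih => simp [List.replicate_succ, ih]

theorem progCode_append (p p' : List Instr) : progCode (p ++ p') = progCode p ++ progCode p' := by
  simp [progCode]

theorem progCode_flatten_replicate (n : ℕ) (p : List Instr) :
    progCode (List.replicate n p).flatten = (List.replicate n (progCode p)).flatten := by
  induction n with
  | zero => rfl
  | succ n ih => simp [List.replicate_succ, progCode_append, ih]

theorem progCode_flatMap {α : Type*} (x : List α) (f : α → List Instr) :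
    progCode (x.flatMap f) = x.flatMap fun a => progCode (f a) := by
  simp [progCode, List.flatMap_assoc]

/-- The code of the straight-line program that is given by a list of building blocks, where pieces
are repeated `(n + 2) ^ e` times for inputs of length `n`. -/
noncomputable def piecesCode (ps : List Piece) (e : ℕ) (x : List Bool) : List Bool :=
  progCode (piecesProg ps ((x.length + 2) ^ e) x)

theorem piecesCode_cons (p : Piece) (ps : List Piece) (e : ℕ) (x : List Bool) :
    piecesCode (p :: ps) e x =
      progCode (p.prog ((x.length + 2) ^ e) x) ++ piecesCode ps e x :=
  progCode_append _ _

theorem polyBdd_length_piecesCode (ps : List Piece) (e : ℕ) :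
    ∃ t, PolyBdd t ∧ ∀ x, (piecesCode ps e x).length ≤ t x.length := by
  induction ps with
  | nil => exact ⟨_, .const 0, fun x => le_rfl⟩
  | cons p ps ih =>
    obtain ⟨t, ht, h⟩ := ih
    obtain ⟨t', ht', h'⟩ : ∃ t, PolyBdd t ∧ ∀ x : List Bool,
        (progCode (p.prog ((x.length + 2) ^ e) x)).length ≤ t x.length := by
      cases p with
      | lit p => exact ⟨_, .const (progCode p).length, fun x => le_rfl⟩
      | rep p =>
        refine ⟨_, ((PolyBdd.id.add (.const 2)).pow e).mul (.const (progCode p).length),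
          fun x => ?_⟩
        simp [Piece.prog, progCode_flatten_replicate]
      | bits f =>
        refine ⟨_, PolyBdd.id.mul (.const ((progCode (f true)).length +
          (progCode (f false)).length)), fun x => ?_⟩
        simp only [Piece.prog, progCode_flatMap]
        induction x with
        | nil => simp
        | cons b x ih =>
          rw [List.flatMap_cons, List.length_append, List.length_cons, Nat.succ_mul]
          cases b <;> omega
    refine ⟨_, ht'.add ht, fun x => ?_⟩
    rw [piecesCode_cons, List.length_append]
    exact Nat.add_le_add (h' x) (h x)

namespace Transducer

variable {ι : Type} [DecidableEq ι] {o inp : ι} {js : List ι} {D : Set ι}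
  {C : ι → Tape (Option Bool)}

/-- Write a word as often as given by nested loops over the tapes in a list. -/
def nest (o : ι) (w : List Bool) : List ι → Transducer ι
  | [] => emitWord o w
  | j :: js => loop j (nest o w js)

/-- A time bound for nested loops. -/
def nestTime (L c : ℕ) : ℕ → ℕ
  | 0 => c + 1
  | e + 1 => L * (nestTime L c e + 4) + 4

theorem polyBdd_nestTime (c e : ℕ) : PolyBdd fun n => nestTime (n + 2) c e := by
  induction e with
  | zero => exact .const _
  | succ e ih => exact ((PolyBdd.id.add (.const 2)).mul (ih.add (.const 4))).add (.const 4)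

/-- A tape that contains a number in unary. -/
def counterTape (L : ℕ) : Tape (Option Bool) := Tape.mk₂ [] ((List.replicate L true).map some)

/-- The exponent is the number of counter tapes, so repeating a word polynomially often needs no
arithmetic on the tapes. The counters must be distinct, because an inner loop has to find its own
counter rewound. -/
theorem emits_nest (w : List Bool) (L : ℕ) (hjs : js.Nodup) (ho : o ∉ js)
    (hC : ∀ j ∈ js, C j = counterTape L) :
    Emits (nest o w js) o {j | j ∈ js} C (List.replicate (L ^ js.length) w).flatten
      (nestTime L w.length js.length) := by
  induction js with
  | nil => simpa [nest, nestTime] using emits_emitWord w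
  | cons j js ih =>
    rw [List.nodup_cons] at hjs
    rw [List.mem_cons, not_or] at ho
    have h := ih hjs.2 ho.2 fun k hk => hC k (List.mem_cons_of_mem _ hk)
    have h' := emits_loop (f := fun _ => (List.replicate (L ^ js.length) w).flatten)
      (Ne.symm ho.1) (D := {j | j ∈ js}) hjs.1 ho.2 (fun _ V hV _ => h V hV)
      (hC j List.mem_cons_self)
    rw [flatMap_replicate, flatten_replicate_mul, List.length_replicate] at h'
    exact h'.mono fun k hk => by simpa using hk

/-- Write the code of the straight-line program that is given by a building block. -/
noncomputable def pieceTrans (o inp : ι) (js : List ι) : Piece → Transducer ι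
  | .lit p => emitWord o (progCode p)
  | .rep p => nest o (progCode p) js
  | .bits f => loop inp (cond inp fun b => emitWord o (progCode (f b)))

theorem emits_pieceTrans (hjs : js.Nodup) (ho : o ∉ js) (hio : inp ≠ o)
    (p : Piece) : ∃ t, PolyBdd t ∧ ∀ (x : List Bool) (C : ι → Tape (Option Bool)),
      C inp = Tape.mk₁ (x.map some) → (∀ j ∈ js, C j = counterTape (x.length + 2)) →
      Emits (pieceTrans o inp js p) o (insert inp {j | j ∈ js}) C
        (progCode (p.prog ((x.length + 2) ^ js.length) x)) (t x.length) := by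
  cases p with
  | lit p => exact ⟨_, .const _, fun x C _ _ => emits_emitWord _⟩
  | rep p =>
    refine ⟨_, polyBdd_nestTime (progCode p).length js.length, fun x C _ hC => ?_⟩
    simp only [Piece.prog, progCode_flatten_replicate]
    exact (emits_nest _ _ hjs ho hC).mono (Set.subset_insert _ _)
  | bits f =>
    refine ⟨_, (PolyBdd.id.mul (.const ((progCode (f true)).length +
      (progCode (f false)).length + 2 + 4))).add (.const 4), fun x C hC _ => ?_⟩
    simp only [Piece.prog, progCode_flatMap]
    refine (emits_loop (f := fun b => progCode (f b)) (D := ∅) hio (by simp) (by simp)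
      (fun b V _ hb => ?_) hC).mono (Set.insert_subset_insert (Set.empty_subset _))
    refine ⟨_, ?_, Runs.cond hb (runs_emitWord o (progCode (f b)) V)⟩
    cases b <;> omega

/-- Write the code of the straight-line program that is given by a list of building blocks. -/
noncomputable def piecesTrans (o inp : ι) (js : List ι) : List Piece → Transducer ι
  | [] => emitWord o []
  | p :: ps => seq (pieceTrans o inp js p) (piecesTrans o inp js ps)

theorem emits_piecesTrans (hjs : js.Nodup) (ho : o ∉ js) (hio : inp ≠ o)
    (ps : List Piece) : ∃ t, PolyBdd t ∧ ∀ (x : List Bool) (C : ι → Tape (Option Bool)),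
      C inp = Tape.mk₁ (x.map some) → (∀ j ∈ js, C j = counterTape (x.length + 2)) →
      Emits (piecesTrans o inp js ps) o (insert inp {j | j ∈ js}) C
        (piecesCode ps js.length x) (t x.length) := by
  induction ps with
  | nil => exact ⟨_, .const _, fun x C _ _ => emits_emitWord _⟩
  | cons p ps ih =>
    obtain ⟨t, ht, h⟩ := emits_pieceTrans hjs ho hio p
    obtain ⟨t', ht', h'⟩ := ih
    refine ⟨_, ht.add ht', fun x C hC hC' => ?_⟩
    rw [piecesCode_cons]
    refine (h x C hC hC').seq ?_ (h' x C hC hC')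
    simpa using ⟨Ne.symm hio, ho⟩

/-- Write the length of the input plus two on a tape, in unary. -/
def initCounter (inp j : ι) : Transducer ι :=
  seq (loop inp (emitWord j [true])) (seq (emitWord j [true, true]) (rewind j))

theorem runs_initCounter {j : ι} (hj : inp ≠ j) (x : List Bool) (V : ι → Tape (Option Bool))
    (hi : V inp = Tape.mk₁ (x.map some)) (hV : V j = Tape.mk₁ []) :
    ∃ n ≤ x.length * 8 + 14,
      (initCounter inp j).Runs V (Function.update V j (counterTape (x.length + 2))) n := by
  have hx : ∀ x : List Bool, x.flatMap (fun _ => [true]) = List.replicate x.length true := by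
    intro x
    induction x with
    | nil => rfl
    | cons b x ih => simp [List.replicate_succ, ih]
  obtain ⟨n, hn, hr⟩ := emits_loop (R := emitWord j [true]) (o := j) (D := ∅) (C := V)
    (f := fun _ => [true]) hj (by simp) (by simp)
    (fun b V _ _ => ⟨_, le_rfl, runs_emitWord j [true] V⟩) hi V (fun _ _ => rfl)
  rw [hx, hV, mk₁_eq_mk₂, emitTape_mk₂, List.append_nil] at hr
  have hr' := runs_emitWord j [true, true] (Function.update V j
    (Tape.mk₂ ((List.replicate x.length true).map some).reverse []))
  rw [Function.update_self, Function.update_idem, emitTape_mk₂, ← List.reverse_append,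
    ← List.map_append,
    show List.replicate x.length true ++ [true, true] = List.replicate (x.length + 2) true from
      List.replicate_append_replicate (n := x.length) (m := 2)] at hr'
  have hr'' := runs_rewind j (List.replicate (x.length + 2) true) _
    (Function.update_self j (Tape.mk₂ ((List.replicate (x.length + 2) true).map some).reverse []) V)
  rw [Function.update_idem] at hr''
  refine ⟨_, ?_, hr.seq (hr'.seq hr'')⟩
  simp only [List.length_cons, List.length_nil, List.length_replicate] at hn ⊢
  omega

/-- Write the length of the input plus two on several tapes. -/
def initCounters (inp : ι) : List ι → Transducer ι
  | [] => prim fun h => (h, fun _ => none)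
  | j :: js => seq (initCounter inp j) (initCounters inp js)

theorem runs_initCounters (hjs : js.Nodup) (hi : inp ∉ js) (x : List Bool)
    (V : ι → Tape (Option Bool)) (hV : V inp = Tape.mk₁ (x.map some))
    (hV' : ∀ j ∈ js, V j = Tape.mk₁ []) :
    ∃ V', ∃ n ≤ js.length * (x.length * 8 + 14) + 1, (initCounters inp js).Runs V V' n ∧
      (∀ j ∈ js, V' j = counterTape (x.length + 2)) ∧ ∀ i ∉ js, V' i = V i := by
  induction js generalizing V with
  | nil =>
    exact ⟨V, 1, by simp, runs_prim fun i => (Tape.write_self _).symm, by simp, by simp⟩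
  | cons j js ih =>
    rw [List.nodup_cons] at hjs
    rw [List.mem_cons, not_or] at hi
    obtain ⟨n, hn, hr⟩ := runs_initCounter hi.1 x V hV (hV' j List.mem_cons_self)
    obtain ⟨V', n', hn', hr', h1, h2⟩ := ih hjs.2 hi.2
      (Function.update V j (counterTape (x.length + 2)))
      (by rw [Function.update_of_ne hi.1, hV]) fun k hk => by
        rw [Function.update_of_ne (by rintro rfl; exact hjs.1 hk),
          hV' k (List.mem_cons_of_mem _ hk)]
    refine ⟨V', n + n', ?_, hr.seq hr', ?_, ?_⟩
    · rw [List.length_cons, Nat.succ_mul]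
      omega
    · intro k hk
      by_cases hkj : k ∈ js
      · exact h1 k hkj
      · rw [h2 k hkj, (List.mem_cons.1 hk).resolve_right hkj, Function.update_self]
    · intro k hk
      rw [List.mem_cons, not_or] at hk
      rw [h2 k hk.2, Function.update_of_ne hk.1]

/-- Compute the code of the straight-line program that is given by a list of building blocks. -/
noncomputable def codeTrans (o inp : ι) (js : List ι) (ps : List Piece) : Transducer ι :=
  seq (initCounters inp js) (seq (piecesTrans o inp js ps) (rewind o))

/-- The last clause ensures that a machine started on the output finds its other tapes blank. The
input tape and the counters keep their contents, but that machine does not use them. -/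
theorem runs_codeTrans (hjs : js.Nodup) (ho : o ∉ js) (hi : inp ∉ js) (hio : inp ≠ o)
    (ps : List Piece) : ∃ t, PolyBdd t ∧ ∀ (x : List Bool) (V : ι → Tape (Option Bool)),
      V inp = Tape.mk₁ (x.map some) → (∀ i, i ≠ inp → V i = Tape.mk₁ []) →
      ∃ V', ∃ n ≤ t x.length, (codeTrans o inp js ps).Runs V V' n ∧
        V' o = Tape.mk₁ ((piecesCode ps js.length x).map some) ∧
        ∀ i, i ≠ inp → i ≠ o → i ∉ js → V' i = Tape.mk₁ [] := by
  obtain ⟨t, ht, h⟩ := emits_piecesTrans hjs ho hio ps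
  obtain ⟨t', ht', h'⟩ := polyBdd_length_piecesCode ps js.length
  refine ⟨_, (((PolyBdd.const js.length).mul ((PolyBdd.id.mul (.const 8)).add (.const 14))).add
    (.const 1)).add (ht.add (((PolyBdd.const 2).mul ht').add (.const 3))), fun x V hV hV' => ?_⟩
  obtain ⟨V₁, n₁, hn₁, hr₁, h1, h2⟩ := runs_initCounters hjs hi x V hV fun j hj =>
    hV' j (by rintro rfl; exact hi hj)
  have hVi : V₁ inp = Tape.mk₁ (x.map some) := by rw [h2 _ hi, hV]
  have hVo : V₁ o = Tape.mk₁ [] := by rw [h2 _ ho, hV' o hio.symm]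
  obtain ⟨n₂, hn₂, hr₂⟩ := h x V₁ hVi h1 V₁ fun _ _ => rfl
  rw [hVo, mk₁_eq_mk₂, emitTape_mk₂, List.append_nil] at hr₂
  have hr₃ := runs_rewind o _ _ (Function.update_self o
    (Tape.mk₂ ((piecesCode ps js.length x).map some).reverse []) V₁)
  refine ⟨_, _, ?_, hr₁.seq (hr₂.seq hr₃), ?_, fun i h3 h4 h5 => ?_⟩
  · have := h' x
    refine Nat.add_le_add hn₁ (Nat.add_le_add hn₂ ?_)
    omega
  · rw [Function.update_self]
    rfl
  · rw [Function.update_of_ne h4, Function.update_of_ne h4, h2 _ h5, hV' _ h3]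

end Transducer

/-! ### Running a machine on the output of a transducer -/

section
variable (e : ℕ) (M : OracleNTM)

/-- The tapes of a machine `M` that is run on the output of a transducer: the input tape, the tapes
of the transducer, and the tapes of `M`. -/
abbrev CompTape : Type := Option (Fin e ⊕ Fin (M.k + 1))

/-- A numbering of the tapes. -/
def compTapeEquiv : Fin (e + (M.k + 1) + 1) ≃ CompTape e M :=
  (finSuccEquiv _).trans finSumFinEquiv.symm.optionCongr

theorem compTapeEquiv_eq_none (i : Fin (e + (M.k + 1) + 1)) :
    compTapeEquiv e M i = none ↔ i = 0 := by
  have h : compTapeEquiv e M 0 = none := by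
    rw [compTapeEquiv, Equiv.trans_apply, finSuccEquiv_zero]
    rfl
  rw [← h]
  exact (compTapeEquiv e M).apply_eq_iff_eq

variable {e M}

/-- Choose the value for a tape of `M` or for another tape. -/
def compSplit {α : Type*} (f : CompTape e M → α) (g : Fin (M.k + 1) → α) : CompTape e M → α
  | some (.inr j) => g j
  | i => f i

theorem compSplit_inr {α : Type*} (f : CompTape e M → α) (g : Fin (M.k + 1) → α)
    (j : Fin (M.k + 1)) : compSplit f g (some (.inr j)) = g j := rfl

/-- The action of the composed machine that carries out an action of `M`. -/
def liftAction {Q : Type} (σ : Fin (e + (M.k + 1) + 1) → Option Bool) (a : Action M.Q M.k) :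
    Action (Q ⊕ M.Q) (e + (M.k + 1)) where
  next := .inr a.next
  write i := compSplit (fun i => σ ((compTapeEquiv e M).symm i)) a.write (compTapeEquiv e M i)
  move i := compSplit (fun _ => none) a.move (compTapeEquiv e M i)
  ask := a.ask

/-- The action of the composed machine that carries out a step of the transducer. -/
def transAction (R : Transducer (CompTape e M)) (s : R.St)
    (σ : Fin (e + (M.k + 1) + 1) → Option Bool) : Action (R.St ⊕ M.Q) (e + (M.k + 1)) :=
  let r := R.step s fun i => σ ((compTapeEquiv e M).symm i)
  { next := (r.1.map .inl).getD (.inr M.start)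
    write := fun i => r.2.1 (compTapeEquiv e M i)
    move := fun i => r.2.2 (compTapeEquiv e M i)
    ask := none }

variable (M) in
/-- The machine that runs `M` on the output of a transducer. -/
def compMachine (R : Transducer (CompTape e M)) : OracleNTM where
  Q := R.St ⊕ M.Q
  finite := have := R.finite; have := M.finite; inferInstance
  k := e + (M.k + 1)
  start := .inl R.start
  accept := .inr M.accept
  query := .inr M.query
  yes := .inr M.yes
  no := .inr M.no
  δ
    | .inl s, σ => {transAction R s σ}
    | .inr q, σ => liftAction σ '' M.δ q fun j => σ ((compTapeEquiv e M).symm (some (.inr j)))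

variable {R : Transducer (CompTape e M)} {A : Set (List Bool)}

theorem compMachine_deterministic (h : M.Deterministic) : (compMachine M R).Deterministic := by
  rintro (s | q) σ
  · exact Set.subsingleton_singleton
  · exact (h _ _).image _

/-- Configurations of the composed machine while the transducer works. -/
def transCfg (R : Transducer (CompTape e M)) (s : Option R.St)
    (V : CompTape e M → Tape (Option Bool)) : (compMachine M R).Cfg :=
  ⟨(s.map Sum.inl).getD (.inr M.start), fun i => V (compTapeEquiv e M i), []⟩

/-- Configurations of the composed machine while `M` works. -/
def liftCfg (R : Transducer (CompTape e M)) (V : CompTape e M → Tape (Option Bool)) (c : M.Cfg) :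
    (compMachine M R).Cfg :=
  ⟨.inr c.state, fun i => compSplit V c.tape (compTapeEquiv e M i), c.queryTape⟩

theorem act_transAction (s : R.St) (V : CompTape e M → Tape (Option Bool)) :
    (compMachine M R).act (transCfg R (some s) V)
      (transAction R s fun i => ((transCfg R (some s) V).tape i).head) =
      transCfg R (R.step s fun i => (V i).head).1 fun i =>
        actTape ((R.step s fun i => (V i).head).2.1 i) ((R.step s fun i => (V i).head).2.2 i)
          (V i) := by
  have h : (fun i => ((transCfg R (some s) V).tape ((compTapeEquiv e M).symm i)).head) =
      fun i => (V i).head := by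
    funext i
    exact congrArg (fun i => (V i).head) ((compTapeEquiv e M).apply_symm_apply i)
  refine cfg_ext ?_ ?_ rfl
  · simp only [OracleNTM.act, transAction, h]
    rfl
  · simp only [transAction, h]
    rfl

/-- The query state of the composed machine belongs to `M`, so the oracle plays no role while the
transducer works. -/
theorem Transducer.Run.detRun {s : Option R.St} {V V' : CompTape e M → Tape (Option Bool)} {n : ℕ}
    (h : R.Run s V V' n) : (compMachine M R).DetRun A (transCfg R s V) (transCfg R none V') n := by
  induction h with
  | exit => exact .refl _
  | @step s V V' n _ ih =>
    refine .step (fun c' => ?_) ih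
    have hq : (transCfg R (some s) V).state ≠ (compMachine M R).query := Sum.inl_ne_inr
    rw [← act_transAction]
    constructor
    · rintro (h | ⟨-, a, ha, rfl⟩)
      · exact absurd h.1 hq
      · obtain rfl : a = _ := ha
        rfl
    · rintro rfl
      exact Or.inr ⟨hq, _, rfl, rfl⟩

theorem liftCfg_head (V : CompTape e M → Tape (Option Bool)) (c : M.Cfg) :
    (fun j => ((liftCfg R V c).tape ((compTapeEquiv e M).symm (some (.inr j)))).head) =
      fun j => (c.tape j).head := by
  funext j
  simp only [liftCfg, Equiv.apply_symm_apply, compSplit_inr]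

theorem act_liftAction (V : CompTape e M → Tape (Option Bool)) (c : M.Cfg) (a : Action M.Q M.k) :
    (compMachine M R).act (liftCfg R V c)
      (liftAction (fun i => ((liftCfg R V c).tape i).head) a) = liftCfg R V (M.act c a) := by
  have h : ∀ i : CompTape e M, actTape (compSplit (fun i => (compSplit V c.tape i).head) a.write i)
      (compSplit (fun _ => none) a.move i) (compSplit V c.tape i) =
      compSplit V (M.act c a).tape i := by
    rintro (_ | _ | j)
    · exact Tape.write_self _
    · exact Tape.write_self _
    · rfl
  have h' : (fun i => ((liftCfg R V c).tape ((compTapeEquiv e M).symm i)).head) =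
      fun i => (compSplit V c.tape i).head := by
    funext i
    exact congrArg (fun i => (compSplit V c.tape i).head) ((compTapeEquiv e M).apply_symm_apply i)
  refine cfg_ext rfl ?_ rfl
  funext i
  change actTape (compSplit (fun i => ((liftCfg R V c).tape ((compTapeEquiv e M).symm i)).head)
    a.write (compTapeEquiv e M i)) (compSplit (fun _ => none) a.move (compTapeEquiv e M i))
    (compSplit V c.tape (compTapeEquiv e M i)) = compSplit V (M.act c a).tape (compTapeEquiv e M i)
  rw [h']
  exact h _

/-- This is the bisimulation hypothesis of `OracleNTM.after_map`; the tapes in `V` that do not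
belong to `M` stay frozen. -/
theorem step_liftCfg (V : CompTape e M → Tape (Option Bool)) (c : M.Cfg)
    (c' : (compMachine M R).Cfg) :
    (compMachine M R).Step A (liftCfg R V c) c' ↔ ∃ d, M.Step A c d ∧ c' = liftCfg R V d := by
  classical
  have hq : (liftCfg R V c).state = (compMachine M R).query ↔ c.state = M.query :=
    Sum.inr_injective.eq_iff
  have hans : (compMachine M R).answer A (liftCfg R V c) = liftCfg R V (M.answer A c) := by
    refine cfg_ext ?_ rfl rfl
    by_cases h : c.queryTape ∈ A <;> simp [OracleNTM.answer, liftCfg, h, compMachine]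
  have hδ : (compMachine M R).δ (liftCfg R V c).state
      (fun i => ((liftCfg R V c).tape i).head) =
      liftAction (fun i => ((liftCfg R V c).tape i).head) ''
        M.δ c.state fun j => (c.tape j).head := by
    rw [← liftCfg_head (R := R) V c]
    rfl
  simp only [OracleNTM.Step, ne_eq, hq, hans, hδ]
  constructor
  · rintro (⟨h, rfl⟩ | ⟨h, _, ⟨a, ha, rfl⟩, rfl⟩)
    · exact ⟨_, Or.inl ⟨h, rfl⟩, rfl⟩
    · exact ⟨_, Or.inr ⟨h, a, ha, rfl⟩, act_liftAction V c a⟩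
  · rintro ⟨_, ⟨h, rfl⟩ | ⟨h, a, ha, rfl⟩, rfl⟩
    · exact Or.inl ⟨h, rfl⟩
    · exact Or.inr ⟨h, _, ⟨a, ha, rfl⟩, (act_liftAction V c a).symm⟩

end

/-- Polynomial time and acceptance are preserved by the reductions that are given by lists of
building blocks. -/
theorem exists_compMachine (ps : List Piece) (e : ℕ) (M : OracleNTM) :
    ∃ M' : OracleNTM, (M.Deterministic → M'.Deterministic) ∧
      ∀ (A : Set (List Bool)) (d : ℕ), M.PolyTime A d → (∃ d', M'.PolyTime A d') ∧
        M'.language A = {x | piecesCode ps e x ∈ M.language A} := by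
  classical
  -- The output tape is tape `0` of `M`, so the computed code is already in place as the input of
  -- `M`.
  let o : CompTape e M := some (.inr 0)
  let js : List (CompTape e M) := (List.finRange e).map fun i => some (.inl i)
  have hjs : js.Nodup := (List.nodup_finRange e).map fun i j h => by simpa using h
  have hlen : js.length = e := by simp [js]
  obtain ⟨t, ht, h⟩ := Transducer.runs_codeTrans (o := o) (inp := none) hjs (by simp [js, o])
    (by simp [js]) (by simp [o]) ps
  obtain ⟨t', ht', h'⟩ := polyBdd_length_piecesCode ps e
  let R := Transducer.codeTrans o none js ps
  have key : ∀ (A : Set (List Bool)) (x : List Bool), ∃ V, ∃ n ≤ t x.length,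
      (compMachine M R).DetRun A ((compMachine M R).init x)
        (liftCfg R V (M.init (piecesCode ps e x))) n := by
    intro A x
    obtain ⟨V', n, hn, hr, h1, h2⟩ := h x
      (fun i => if i = none then Tape.mk₁ (x.map some) else Tape.mk₁ []) rfl
      (fun i hi => if_neg hi)
    refine ⟨V', n, hn, ?_⟩
    have h3 := Transducer.Run.detRun (A := A) hr
    have h4 : transCfg R (some R.start)
        (fun i => if i = none then Tape.mk₁ (x.map some) else Tape.mk₁ []) =
        (compMachine M R).init x := by
      refine cfg_ext rfl ?_ rfl
      funext i
      exact if_congr (compTapeEquiv_eq_none e M i) rfl rfl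
    have h5 : transCfg R none V' = liftCfg R V' (M.init (piecesCode ps e x)) := by
      refine cfg_ext rfl ?_ rfl
      funext i
      simp only [transCfg, liftCfg]
      rcases compTapeEquiv e M i with _ | i | j
      · rfl
      · rfl
      · rw [compSplit_inr]
        by_cases hj : j = 0
        · subst hj
          rw [h1, hlen]
          rfl
        · rw [h2 (some (.inr j)) (by simp) (by simpa [o] using hj) (by simp [js])]
          simp [OracleNTM.init, hj]
    rw [← h4, ← h5]
    exact h3
  refine ⟨compMachine M R, compMachine_deterministic, fun A d hM => ⟨?_, ?_⟩⟩
  -- The time is that of the transducer plus that of `M` on a code of polynomial length.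
  · obtain ⟨D, hD⟩ := (ht.add ((ht'.pow d).add (.const d))).exists_pow_add
    refine ⟨D, fun x => ?_⟩
    rw [OracleNTM.haltsWithin_iff]
    obtain ⟨V, n, hn, hr⟩ := key A x
    have h1 := (OracleNTM.boundFrom_map (step_liftCfg (R := R) V) _ _).2
      ((OracleNTM.haltsWithin_iff _ _).1 (hM (piecesCode ps e x)))
    refine (hr.boundFrom h1).mono (le_trans (Nat.add_le_add hn ?_) (hD x.length))
    exact Nat.add_le_add_right (Nat.pow_le_pow_left (h' x) d) d
  · ext x
    obtain ⟨V, n, hn, hr⟩ := key A x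
    change (compMachine M R).Accepts A x ↔ M.Accepts A _
    rw [OracleNTM.accepts_iff, OracleNTM.accepts_iff, hr.acceptsFrom_iff]
    exact OracleNTM.acceptsFrom_map (step_liftCfg V) (fun c => Sum.inr_injective.eq_iff) _

/-! ### Completeness of the evaluator -/

theorem preimage_mem_P {A : Set (List Bool)} {L : Set (List Bool)} (hL : L ∈ P A)
    (ps : List Piece) (e : ℕ) : {x | piecesCode ps e x ∈ L} ∈ P A := by
  obtain ⟨M, hdet, ⟨d, hd⟩, rfl⟩ := hL
  obtain ⟨M', hdet', h⟩ := exists_compMachine ps e M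
  exact ⟨M', hdet' hdet, h A d hd⟩

theorem preimage_mem_NP {A : Set (List Bool)} {L : Set (List Bool)} (hL : L ∈ NP A)
    (ps : List Piece) (e : ℕ) : {x | piecesCode ps e x ∈ L} ∈ NP A := by
  obtain ⟨M, ⟨d, hd⟩, rfl⟩ := hL
  obtain ⟨M', -, h⟩ := exists_compMachine ps e M
  exact ⟨M', h A d hd⟩

theorem P_subset_NP (A : Set (List Bool)) : P A ⊆ NP A :=
  fun _ ⟨M, _, h⟩ => ⟨M, h⟩

theorem evaluator_mem_NP (A : Set (List Bool)) : evaluator.language A ∈ NP A :=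
  ⟨evaluator, evaluator_polyTime.imp fun _ h => h A, rfl⟩

theorem exists_reduction {A : Set (List Bool)} {L : Set (List Bool)} (hL : L ∈ NP A) :
    ∃ ps e, L = {x | piecesCode ps e x ∈ evaluator.language A} := by
  obtain ⟨N, ⟨d, hd⟩, rfl⟩ := hL
  obtain ⟨ps, h⟩ := exists_pieces N
  exact ⟨ps, d + 1, Set.ext fun x => h A d hd x⟩

theorem evaluator_mem_P_iff (A : Set (List Bool)) : evaluator.language A ∈ P A ↔ P A = NP A := by
  refine ⟨fun h => (P_subset_NP A).antisymm fun L hL => ?_, fun h => h ▸ evaluator_mem_NP A⟩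
  obtain ⟨ps, e, rfl⟩ := exists_reduction hL
  exact preimage_mem_P h ps e

/-- Complements commute with preimages under a reduction, so one complement in NP^A puts all of NP^A
into co-NP^A; the converse inclusion follows by taking complements. -/
theorem evaluator_compl_mem_NP_iff (A : Set (List Bool)) :
    (evaluator.language A)ᶜ ∈ NP A ↔ NP A = coNP A := by
  refine ⟨fun h => ?_, fun h => ?_⟩
  · have h1 : NP A ⊆ coNP A := by
      intro L hL
      obtain ⟨ps, e, rfl⟩ := exists_reduction hL
      exact preimage_mem_NP h ps e
    exact h1.antisymm fun L hL => by simpa [coNP] using h1 hL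
  · have h1 : evaluator.language A ∈ coNP A := h ▸ evaluator_mem_NP A
    exact h1

/-! ### Coded machines -/

/-- A coded transition: the state and the scanned symbols; the next state, the written symbols with
the head movements (`false` for left, `true` for right), and the bit appended to the query. -/
abbrev TransCode : Type :=
  (ℕ × List (Option Bool)) × ℕ × List (Option Bool × Option Bool) × Option Bool

/-- A coded machine: `(k, N)`; the start, accepting, query, `yes` and `no` states, which are taken
modulo `N + 1`; and the transitions. -/
abbrev Code : Type := (ℕ × ℕ) × (ℕ × ℕ × ℕ × ℕ × ℕ) × List TransCode

namespace Code

/-- The number of work tapes minus one. -/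
def k (c : Code) : ℕ := c.1.1

/-- The number of states. -/
def size (c : Code) : ℕ := c.1.2 + 1

instance (c : Code) : NeZero c.size := ⟨Nat.succ_ne_zero _⟩

def start (c : Code) : ℕ := c.2.1.1 % c.size

def accept (c : Code) : ℕ := c.2.1.2.1 % c.size

def query (c : Code) : ℕ := c.2.1.2.2.1 % c.size

def yes (c : Code) : ℕ := c.2.1.2.2.2.1 % c.size

def no (c : Code) : ℕ := c.2.1.2.2.2.2 % c.size

/-- The coded transitions that are possible in state `q` when the symbols `s` are scanned; if `det`
is true then only the first one is taken. -/
def lookups (det : Bool) (c : Code) (q : ℕ) (s : List (Option Bool)) :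
    List (ℕ × List (Option Bool × Option Bool) × Option Bool) :=
  (c.2.2.filterMap fun r => if r.1 = (q, s) then some r.2 else none).take
    (if det then 1 else c.2.2.length)

/-- Decode a head movement. -/
def dirOf (m : Option Bool) : Option Dir := m.map fun b => if b then .right else .left

/-- Decode an action. -/
def toAction (c : Code) (u : ℕ × List (Option Bool × Option Bool) × Option Bool) :
    Action (Fin c.size) c.k where
  next := Fin.ofNat c.size u.1
  write i := (u.2.1.getD i default).1
  move i := dirOf (u.2.1.getD i default).2
  ask := u.2.2

/-- The machine with a given code. -/
def machine (det : Bool) (c : Code) : OracleNTM where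
  Q := Fin c.size
  finite := inferInstance
  k := c.k
  start := Fin.ofNat _ c.start
  accept := Fin.ofNat _ c.accept
  query := Fin.ofNat _ c.query
  yes := Fin.ofNat _ c.yes
  no := Fin.ofNat _ c.no
  δ q s := {a | ∃ u ∈ c.lookups det q (List.ofFn s), a = c.toAction u}

/-- As surplus transitions are ignored, every code is admissible, and a quantifier over
deterministic machines becomes a quantifier over all codes without a side condition. -/
theorem machine_deterministic (c : Code) : (c.machine true).Deterministic := by
  rintro (q : Fin c.size) s _ ⟨u, hu, rfl⟩ _ ⟨v, hv, rfl⟩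
  refine congrArg c.toAction ?_
  have h : (c.lookups true q (List.ofFn s)).length ≤ 1 := by
    rw [lookups, List.length_take]
    exact min_le_left _ _
  obtain ⟨i, hi, rfl⟩ := List.getElem_of_mem hu
  obtain ⟨j, hj, rfl⟩ := List.getElem_of_mem hv
  have hij : i = j := by
    have hi' : i < (c.lookups true q (List.ofFn s)).length := hi
    have hj' : j < (c.lookups true q (List.ofFn s)).length := hj
    omega
  subst hij
  rfl

end Code

open Code

theorem mem_take_one {α : Type*} {l : List α} (h : ∀ a ∈ l, ∀ b ∈ l, a = b) (a : α) :
    a ∈ l.take 1 ↔ a ∈ l := by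
  cases l with
  | nil => simp
  | cons b l =>
    simp only [List.take_succ_cons, List.take_zero, List.mem_singleton]
    exact ⟨fun h' => h' ▸ List.mem_cons_self, fun h' => h _ h' _ List.mem_cons_self⟩

/-- Every machine is equivalent to a coded machine. -/
theorem exists_code (M : OracleNTM) (det : Bool) (hM : det = true → M.Deterministic) :
    ∃ c : Code, ∀ A, (c.machine det).language A = M.language A ∧
      ∀ d, (c.machine det).PolyTime A d ↔ M.PolyTime A d := by
  classical
  have := M.finite
  obtain ⟨n, ⟨e⟩⟩ := Finite.exists_equiv_fin M.Q
  obtain ⟨N, rfl⟩ : ∃ N, n = N + 1 := ⟨n - 1, by have := (e M.start).pos; omega⟩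
  have : Finite (Action M.Q M.k) := by
    refine Finite.of_injective (fun a : Action M.Q M.k => (a.next, a.write, a.move, a.ask))
      fun a b h => ?_
    cases a
    cases b
    simpa using h
  let codeAct (a : Action M.Q M.k) : ℕ × List (Option Bool × Option Bool) × Option Bool :=
    (e a.next, List.ofFn fun i => (a.write i, (a.move i).map fun d => decide (d = .right)), a.ask)
  let codeTr (r : M.Q × (Fin (M.k + 1) → Option Bool) × Action M.Q M.k) : TransCode :=
    ((e r.1, List.ofFn r.2.1), codeAct r.2.2)
  let T : Set (M.Q × (Fin (M.k + 1) → Option Bool) × Action M.Q M.k) := {r | r.2.2 ∈ M.δ r.1 r.2.1}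
  let c : Code := ((M.k, N), (e M.start, e M.accept, e M.query, e M.yes, e M.no),
    T.toFinite.toFinset.toList.map codeTr)
  have hsize : c.size = N + 1 := rfl
  have hmod : ∀ q, (e q : ℕ) % c.size = e q := fun q => Nat.mod_eq_of_lt (e q).isLt
  have hof : ∀ q, Fin.ofNat c.size (e q : ℕ) = e q := fun q => Fin.ext (hmod q)
  have hmem : ∀ q s u, u ∈ (c.2.2.filterMap fun r =>
      if r.1 = ((e q : ℕ), List.ofFn s) then some r.2 else none) ↔
      ∃ a ∈ M.δ q s, u = codeAct a := by
    intro q s u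
    simp only [c, List.mem_filterMap, List.mem_map, Finset.mem_toList, Set.Finite.mem_toFinset]
    constructor
    · rintro ⟨_, ⟨⟨q', s', a⟩, hr, rfl⟩, h⟩
      split_ifs at h with h'
      simp only [codeTr, Prod.mk.injEq, List.ofFn_inj] at h'
      obtain ⟨h1, rfl⟩ := h'
      obtain rfl := e.injective (Fin.ext h1)
      exact ⟨a, hr, (Option.some.inj h).symm⟩
    · rintro ⟨a, ha, rfl⟩
      exact ⟨_, ⟨(q, s, a), ha, rfl⟩, by simp [codeTr]⟩
  have hlook : ∀ q s u, u ∈ c.lookups det (e q : ℕ) (List.ofFn s) ↔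
      ∃ a ∈ M.δ q s, u = codeAct a := by
    intro q s u
    rw [← hmem, lookups]
    cases det with
    | false =>
      rw [List.take_of_length_le]
      exact List.length_filterMap_le _ _
    | true =>
      -- Nothing is lost by keeping only the first match: for deterministic `M` all matching
      -- transitions are equal.
      refine mem_take_one (fun v hv w hw => ?_) u
      obtain ⟨a, ha, rfl⟩ := (hmem q s v).1 hv
      obtain ⟨b, hb, rfl⟩ := (hmem q s w).1 hw
      rw [hM rfl q s ha hb]
  have hact : ∀ a, c.toAction (codeAct a) = ⟨e a.next, a.write, a.move, a.ask⟩ := by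
    intro a
    have h1 : ∀ i : Fin (M.k + 1), (codeAct a).2.1.getD i default =
        (a.write i, (a.move i).map fun d => decide (d = .right)) := by
      intro i
      exact (List.getD_eq_getElem _ _ (by simpa [codeAct] using i.is_le)).trans (List.getElem_ofFn _)
    have h2 : (fun i : Fin (M.k + 1) => ((codeAct a).2.1.getD i default).1) = a.write :=
      funext fun i => by rw [h1]
    have h3 : (fun i : Fin (M.k + 1) => dirOf ((codeAct a).2.1.getD i default).2) = a.move := by
      funext i
      rw [h1]
      rcases a.move i with _ | _ | _ <;> rfl
    have h4 : ∀ (q : Fin (N + 1)) (w : Fin (M.k + 1) → Option Bool)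
        (m : Fin (M.k + 1) → Option Dir), q = e a.next → w = a.write → m = a.move →
        (⟨q, w, m, a.ask⟩ : Action (Fin (N + 1)) M.k) = ⟨e a.next, a.write, a.move, a.ask⟩ := by
      rintro _ _ _ rfl rfl rfl
      rfl
    exact h4 _ _ _ (hof _) h2 h3
  -- The coded machine is `M` with renumbered states; since steps correspond one to one, time bounds
  -- are preserved exactly.
  let f (C : M.Cfg) : (c.machine det).Cfg := ⟨e C.state, C.tape, C.queryTape⟩
  have hof' : ∀ q, Fin.ofNat c.size ((e q : ℕ) % c.size) = e q := fun q => by rw [hmod, hof]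
  have hq : ∀ C, (f C).state = (c.machine det).query ↔ C.state = M.query := fun C =>
    ⟨fun h => e.injective (h.trans (hof' _)), fun h => (congrArg e h).trans (hof' _).symm⟩
  have hacc : ∀ C, (f C).state = (c.machine det).accept ↔ C.state = M.accept := fun C =>
    ⟨fun h => e.injective (h.trans (hof' _)), fun h => (congrArg e h).trans (hof' _).symm⟩
  have hans : ∀ A C, (c.machine det).answer A (f C) = f (M.answer A C) := by
    intro A C
    have hyes : (c.machine det).yes = e M.yes := hof' _
    have hno : (c.machine det).no = e M.no := hof' _
    refine cfg_ext ?_ rfl rfl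
    by_cases h : C.queryTape ∈ A
    · exact (if_pos h).trans (hyes.trans (congrArg e (if_pos h).symm))
    · exact (if_neg h).trans (hno.trans (congrArg e (if_neg h).symm))
  have hstep : ∀ A C C', (c.machine det).Step A (f C) C' ↔ ∃ D, M.Step A C D ∧ C' = f D := by
    intro A C C'
    constructor
    · rintro (⟨h, rfl⟩ | ⟨h, _, ⟨u, hu, rfl⟩, rfl⟩)
      · exact ⟨M.answer A C, Or.inl ⟨(hq C).1 h, rfl⟩, hans A C⟩
      · obtain ⟨a, ha, rfl⟩ := (hlook C.state _ u).1 hu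
        exact ⟨M.act C a, Or.inr ⟨fun h' => h ((hq C).2 h'), a, ha, rfl⟩,
          congrArg ((c.machine det).act (f C)) (hact a)⟩
    · rintro ⟨D, ⟨h, rfl⟩ | ⟨h, a, ha, rfl⟩, rfl⟩
      · exact Or.inl ⟨(hq C).2 h, (hans A C).symm⟩
      · exact Or.inr ⟨fun h' => h ((hq C).1 h'), _, ⟨codeAct a, (hlook _ _ _).2 ⟨a, ha, rfl⟩, rfl⟩,
          (congrArg ((c.machine det).act (f C)) (hact a)).symm⟩
  have hinit : ∀ x, (c.machine det).init x = f (M.init x) := fun x => cfg_ext (hof' _) rfl rfl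
  refine ⟨c, fun A => ⟨?_, fun d => ?_⟩⟩
  · ext x
    exact (OracleNTM.accepts_iff x).trans
      ((hinit x ▸ OracleNTM.acceptsFrom_map (hstep A) hacc _).trans
        (OracleNTM.accepts_iff x).symm)
  · refine forall_congr' fun x => ?_
    rw [OracleNTM.haltsWithin_iff, OracleNTM.haltsWithin_iff, hinit,
      OracleNTM.boundFrom_map (hstep A)]

/-! ### Simulation of coded machines on lists -/

/-- A list representation of configurations: the state, the tapes (with the part to the left of the
head in reverse order), and the string on the query tape. -/
abbrev LCfg : Type := ℕ × List (List (Option Bool) × List (Option Bool)) × List Bool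

/-- The symbol scanned. -/
def listHead (p : List (Option Bool) × List (Option Bool)) : Option Bool := p.2.headI

/-- Write and move. -/
def listUpdate (u : Option Bool × Option Bool) (p : List (Option Bool) × List (Option Bool)) :
    List (Option Bool) × List (Option Bool) :=
  match u.2 with
  | none => (p.1, u.1 :: p.2.tail)
  | some b => if b then (u.1 :: p.1, p.2.tail) else (p.1.tail, p.1.headI :: u.1 :: p.2.tail)

theorem mk₂_head_eq (l r : List (Option Bool)) : (Tape.mk₂ l r).head = r.headI := by
  simp [Tape.mk₂]

theorem mk₂_listUpdate (u : Option Bool × Option Bool)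
    (p : List (Option Bool) × List (Option Bool)) :
    Tape.mk₂ (listUpdate u p).1 (listUpdate u p).2 =
      actTape u.1 (dirOf u.2) (Tape.mk₂ p.1 p.2) := by
  obtain ⟨w, _ | _ | _⟩ := u <;>
    simp [listUpdate, actTape, dirOf, Tape.mk₂, Tape.move_left_mk', Tape.move_right_mk']

namespace Code

/-- The configurations that can follow, where the oracle is given by an initial segment of its
characteristic function. -/
def listStep (det : Bool) (c : Code) (σ : List Bool) (l : LCfg) : List LCfg :=
  if l.1 % c.size = c.query then
    [(if σ.getD (strIndex l.2.2) false then c.yes else c.no, l.2.1, [])]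
  else (c.lookups det (l.1 % c.size)
    ((List.range (c.k + 1)).map fun i => listHead (l.2.1.getD i default))).map fun u =>
      (u.1, (List.range (c.k + 1)).map fun i =>
        listUpdate (u.2.1.getD i default) (l.2.1.getD i default), l.2.2 ++ u.2.2.toList)

/-- The configuration with a given list representation. -/
def decodeCfg (det : Bool) (c : Code) (l : LCfg) : (c.machine det).Cfg where
  state := Fin.ofNat c.size l.1
  tape i := Tape.mk₂ (l.2.1.getD i default).1 (l.2.1.getD i default).2
  queryTape := l.2.2

/-- The configurations after `n` steps. -/
def listAfter (det : Bool) (c : Code) (σ : List Bool) (x : List Bool) (n : ℕ) : List LCfg :=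
  n.rec [(c.start, [([], x.map some)], [])] fun _ ls => ls.flatMap (c.listStep det σ)

end Code

/-- The oracle that is given by an initial segment of its characteristic function, and contains
nothing beyond. -/
def listOracle (σ : List Bool) : Set (List Bool) := oracle fun i => σ.getD i false

namespace Code

variable {det : Bool} {c : Code} {σ : List Bool}

theorem step_decodeCfg (l : LCfg) (C : (c.machine det).Cfg) :
    (c.machine det).Step (listOracle σ) (c.decodeCfg det l) C ↔
      ∃ l' ∈ c.listStep det σ l, C = c.decodeCfg det l' := by
  have hq : (c.decodeCfg det l).state = (c.machine det).query ↔ l.1 % c.size = c.query := by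
    refine Fin.ext_iff.trans ?_
    change l.1 % c.size = c.query % c.size ↔ _
    rw [Nat.mod_eq_of_lt (a := c.query) (Nat.mod_lt _ (Nat.succ_pos _))]
  have hans : (c.machine det).answer (listOracle σ) (c.decodeCfg det l) = c.decodeCfg det
      (if σ.getD (strIndex l.2.2) false then c.yes else c.no, l.2.1, []) := by
    refine cfg_ext ?_ rfl rfl
    by_cases h : σ.getD (strIndex l.2.2) false = true
    · rw [if_pos h]
      exact if_pos h
    · rw [if_neg h]
      exact if_neg h
  have hscan : (List.ofFn fun i => ((c.decodeCfg det l).tape i).head) =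
      (List.range (c.k + 1)).map fun i => listHead (l.2.1.getD i default) := by
    refine List.ext_getElem ?_ fun i h1 h2 => ?_
    · rw [List.length_ofFn, List.length_map, List.length_range]
      rfl
    · rw [List.getElem_ofFn, List.getElem_map, List.getElem_range]
      exact mk₂_head_eq _ _
  have hact : ∀ u : ℕ × List (Option Bool × Option Bool) × Option Bool,
      (c.machine det).act (c.decodeCfg det l) (c.toAction u) = c.decodeCfg det
        (u.1, (List.range (c.k + 1)).map fun i =>
          listUpdate (u.2.1.getD i default) (l.2.1.getD i default), l.2.2 ++ u.2.2.toList) := by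
    intro u
    refine cfg_ext rfl ?_ rfl
    funext (i : Fin (c.k + 1))
    have h : ((List.range (c.k + 1)).map fun i =>
        listUpdate (u.2.1.getD i default) (l.2.1.getD i default)).getD i default =
        listUpdate (u.2.1.getD i default) (l.2.1.getD i default) := by
      rw [List.getD_eq_getElem _ _ (by simpa using i.is_le), List.getElem_map, List.getElem_range]
    refine Eq.trans ?_ (congrArg (fun p : List (Option Bool) × List (Option Bool) =>
      Tape.mk₂ p.1 p.2) h).symm
    exact (mk₂_listUpdate _ _).symm
  rw [listStep]
  by_cases h : l.1 % c.size = c.query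
  · simp only [if_pos h, List.mem_singleton, exists_eq_left, ← hans]
    exact ⟨fun h' => h'.elim (·.2) fun h' => absurd (hq.2 h) h'.1, fun h' => Or.inl ⟨hq.2 h, h'⟩⟩
  · rw [if_neg h]
    constructor
    · rintro (⟨h', -⟩ | ⟨-, _, ⟨u, hu, rfl⟩, rfl⟩)
      · exact absurd (hq.1 h') h
      · exact ⟨_, List.mem_map.2 ⟨u, hscan ▸ hu, rfl⟩, hact u⟩
    · rintro ⟨_, h', rfl⟩
      obtain ⟨u, hu, rfl⟩ := List.mem_map.1 h'
      exact Or.inr ⟨fun h' => h (hq.1 h'), _, ⟨u, hscan ▸ hu, rfl⟩, (hact u).symm⟩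

/-- Only the input tape is listed: missing entries have the default value `([], [])`, which decodes
to a blank tape. -/
theorem init_eq (x : List Bool) :
    c.decodeCfg det (c.start, [([], x.map some)], []) = (c.machine det).init x := by
  refine cfg_ext rfl ?_ rfl
  funext (i : Fin (c.k + 1))
  rcases Fin.eq_zero_or_eq_succ i with rfl | ⟨j, rfl⟩ <;> rfl

theorem after_eq (x : List Bool) (n : ℕ) :
    (c.machine det).after (listOracle σ) ((c.machine det).init x) n =
      c.decodeCfg det '' {l | l ∈ c.listAfter det σ x n} := by
  induction n with
  | zero =>
    rw [← init_eq]
    ext C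
    simp [OracleNTM.after, listAfter]
  | succ n ih =>
    ext C
    simp only [OracleNTM.after, ih, Set.mem_image, Set.mem_ofPred_eq, listAfter, List.mem_flatMap]
    constructor
    · rintro ⟨_, ⟨l, hl, rfl⟩, h⟩
      obtain ⟨l', hl', rfl⟩ := (step_decodeCfg _ _).1 h
      exact ⟨l', ⟨l, hl, hl'⟩, rfl⟩
    · rintro ⟨l', ⟨l, hl, hl'⟩, rfl⟩
      exact ⟨_, ⟨l, hl, rfl⟩, (step_decodeCfg _ _).2 ⟨l', hl', rfl⟩⟩

end Code

/-! ### Bounded computations use a finite part of the oracle -/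

namespace OracleNTM

variable {M : OracleNTM} {A B : Set (List Bool)}

theorem step_congr {c d : M.Cfg} (h : c.queryTape ∈ A ↔ c.queryTape ∈ B) :
    M.Step A c d ↔ M.Step B c d := by
  have h' : M.answer A c = M.answer B c := by
    refine cfg_ext ?_ rfl rfl
    by_cases h' : c.queryTape ∈ A
    · exact (if_pos h').trans (if_pos (h.1 h')).symm
    · exact (if_neg h').trans (if_neg fun hb => h' (h.2 hb)).symm
  rw [Step, Step, h']

theorem length_queryTape_le {c d : M.Cfg} {n : ℕ} (h : d ∈ M.after A c n) :
    d.queryTape.length ≤ c.queryTape.length + n := by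
  induction n generalizing d with
  | zero =>
    obtain rfl : d = c := h
    exact le_rfl
  | succ n ih =>
    obtain ⟨e, he, ⟨-, rfl⟩ | ⟨-, a, -, rfl⟩⟩ := h
    · exact Nat.zero_le _
    · have := ih he
      have h' : a.ask.toList.length ≤ 1 := by cases a.ask <;> simp
      simp only [act, List.length_append]
      omega

/-- The configurations that are reached within `t + 1` steps depend only on the answers to
questions of length at most `t`. -/
theorem after_congr {t n : ℕ} (h : ∀ w : List Bool, w.length ≤ t → (w ∈ A ↔ w ∈ B))
    (x : List Bool) (hn : n ≤ t + 1) : M.after A (M.init x) n = M.after B (M.init x) n := by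
  induction n with
  | zero => rfl
  | succ n ih =>
    have ih := ih (by omega)
    ext c
    simp only [after, Set.mem_ofPred_eq, ← ih]
    refine exists_congr fun d => and_congr_right fun hd => step_congr (h _ ?_)
    -- Each step appends at most one bit, so a question asked after `n ≤ t` steps has length at most
    -- `t`.
    have := length_queryTape_le hd
    simp only [init, List.length_nil] at this
    omega

theorem haltsWithin_congr {t : ℕ} (h : ∀ w : List Bool, w.length ≤ t → (w ∈ A ↔ w ∈ B))
    (x : List Bool) : M.HaltsWithin A x t ↔ M.HaltsWithin B x t := by
  rw [haltsWithin_iff, haltsWithin_iff, BoundFrom, BoundFrom, after_congr h x le_rfl]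

/-- `M^A` accepts `x` within `t` steps. -/
def AcceptsWithin (M : OracleNTM) (A : Set (List Bool)) (x : List Bool) (t : ℕ) : Prop :=
  ∃ n < t + 1, ∃ c ∈ M.after A (M.init x) n, (∀ d, ¬ M.Step A c d) ∧ c.state = M.accept

theorem HaltsWithin.accepts_iff {x : List Bool} {t : ℕ} (h : M.HaltsWithin A x t) :
    M.Accepts A x ↔ M.AcceptsWithin A x t := by
  rw [OracleNTM.accepts_iff]
  refine ⟨fun ⟨n, c, hc, h'⟩ => ⟨n, ?_, c, hc, h'⟩, fun ⟨n, _, h'⟩ => ⟨n, h'⟩⟩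
  by_contra hn
  rw [after_eq_empty_of_le (not_lt.1 hn) ((haltsWithin_iff x t).1 h)] at hc
  exact hc

theorem acceptsWithin_congr {t : ℕ} (h : ∀ w : List Bool, w.length ≤ t → (w ∈ A ↔ w ∈ B))
    (x : List Bool) : M.AcceptsWithin A x t ↔ M.AcceptsWithin B x t := by
  refine exists_congr fun n => and_congr_right fun hn => ?_
  rw [after_congr h x hn.le]
  refine exists_congr fun c => and_congr_right fun hc => ?_
  simp only [fun d => step_congr (d := d) (h c.queryTape (by
    have := length_queryTape_le hc
    simp only [init, List.length_nil] at this
    omega))]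

end OracleNTM

/-- The last string of length `n` is `1…1`, with index `2 ^ (n + 1) - 2`. -/
theorem strIndex_add_two_le (w : List Bool) : strIndex w + 2 ≤ 2 ^ (w.length + 1) := by
  induction w using List.reverseRecOn with
  | nil => simp [strIndex]
  | append_singleton w b ih =>
    rw [strIndex_append_singleton, List.length_append, List.length_singleton, pow_succ]
    have := b.toNat_le
    omega

/-- The segment covers all strings of length at most `t`, so the default answer `false` beyond its
end is not used for them. -/
theorem mem_listOracle {f : ℕ → Bool} {m t : ℕ} (hm : 2 ^ (t + 1) ≤ m) (w : List Bool)
    (hw : w.length ≤ t) : w ∈ listOracle ((List.range m).map f) ↔ w ∈ oracle f := by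
  have h1 := strIndex_add_two_le w
  have h2 : 2 ^ (w.length + 1) ≤ 2 ^ (t + 1) := Nat.pow_le_pow_right two_pos (by omega)
  have h3 : ((List.range m).map f).getD (strIndex w) false = f (strIndex w) := by
    rw [List.getD_eq_getElem _ _ (by rw [List.length_map, List.length_range]; omega),
      List.getElem_map, List.getElem_range]
  exact iff_of_eq (congrArg (· = true) h3)

namespace Code

/-- All computation paths have length at most `t`. -/
def ListHalts (det : Bool) (c : Code) (σ x : List Bool) (t : ℕ) : Prop :=
  c.listAfter det σ x (t + 1) = []

/-- Some computation path of length at most `t` accepts. -/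
def ListAccepts (det : Bool) (c : Code) (σ x : List Bool) (t : ℕ) : Prop :=
  ∃ l ∈ (List.range (t + 1)).flatMap (c.listAfter det σ x),
    c.listStep det σ l = [] ∧ l.1 % c.size = c.accept

variable {det : Bool} {c : Code} {σ : List Bool}

theorem listHalts_iff (x : List Bool) (t : ℕ) :
    c.ListHalts det σ x t ↔ (c.machine det).HaltsWithin (listOracle σ) x t := by
  rw [OracleNTM.haltsWithin_iff, OracleNTM.BoundFrom, after_eq, Set.image_eq_empty, ListHalts,
    List.eq_nil_iff_forall_not_mem, Set.eq_empty_iff_forall_notMem]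
  rfl

theorem listAccepts_iff (x : List Bool) (t : ℕ) :
    c.ListAccepts det σ x t ↔ (c.machine det).AcceptsWithin (listOracle σ) x t := by
  have h1 : ∀ l : LCfg, (∀ d, ¬ (c.machine det).Step (listOracle σ) (c.decodeCfg det l) d) ↔
      c.listStep det σ l = [] := by
    intro l
    simp only [step_decodeCfg, List.eq_nil_iff_forall_not_mem]
    exact ⟨fun h l' hl' => h _ ⟨l', hl', rfl⟩, fun h _ ⟨l', hl', _⟩ => h l' hl'⟩
  have h2 : ∀ l : LCfg, (c.decodeCfg det l).state = (c.machine det).accept ↔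
      l.1 % c.size = c.accept := by
    intro l
    refine Fin.ext_iff.trans ?_
    change l.1 % c.size = c.accept % c.size ↔ _
    rw [Nat.mod_eq_of_lt (a := c.accept) (Nat.mod_lt _ (Nat.succ_pos _))]
  simp only [ListAccepts, OracleNTM.AcceptsWithin, after_eq, Set.exists_mem_image, h1, h2,
    List.mem_flatMap, List.mem_range, Set.mem_ofPred_eq]
  exact ⟨fun ⟨l, ⟨n, hn, hl⟩, h⟩ => ⟨n, hn, l, hl, h⟩, fun ⟨n, hn, l, hl, h⟩ => ⟨l, ⟨n, hn, hl⟩, h⟩⟩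

end Code

/-! ### Primitive recursiveness of the simulation -/

open Primrec

theorem _root_.Primrec.nat_pow : Primrec₂ ((· ^ ·) : ℕ → ℕ → ℕ) :=
  Primrec₂.unpaired'.1 Nat.Primrec.pow

theorem primrec_strIndex : Primrec strIndex :=
  list_foldl (h := fun _ (p : ℕ × Bool) => 2 * p.1 + 1 + p.2.toNat) Primrec.id (const 0)
    (nat_add.comp (succ.comp (nat_mul.comp (const 2) (fst.comp snd)))
      ((dom_finite Bool.toNat).comp (snd.comp snd)))

theorem primrec_listUpdate : Primrec₂ listUpdate := by
  have hp : Primrec fun a : ((Option Bool × Option Bool) ×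
      (List (Option Bool) × List (Option Bool))) × Bool => a.1.2 := snd.comp fst
  have hu : Primrec fun a : ((Option Bool × Option Bool) ×
      (List (Option Bool) × List (Option Bool))) × Bool => a.1.1.1 := fst.comp (fst.comp fst)
  have := option_casesOn
    (o := fun a : (Option Bool × Option Bool) × (List (Option Bool) × List (Option Bool)) => a.1.2)
    (f := fun a => (a.2.1, a.1.1 :: a.2.2.tail))
    (g := fun a b => if b = true then (a.1.1 :: a.2.1, a.2.2.tail)
      else (a.2.1.tail, a.2.1.headI :: a.1.1 :: a.2.2.tail))
    (snd.comp fst)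
    (pair (fst.comp snd) (list_cons.comp (fst.comp fst) (list_tail.comp (snd.comp snd))))
    (Primrec.ite (Primrec.eq.comp snd (const true))
      (pair (list_cons.comp hu (fst.comp hp)) (list_tail.comp (snd.comp hp)))
      (pair (list_tail.comp (fst.comp hp)) (list_cons.comp (list_headI.comp (fst.comp hp))
        (list_cons.comp hu (list_tail.comp (snd.comp hp))))))
  refine this.of_eq fun ⟨⟨w, m⟩, p⟩ => ?_
  cases m <;> rfl

theorem primrec_filterMap_lookup {α β : Type*} [Primcodable α] [Primcodable β] [DecidableEq α] :
    Primrec₂ fun (T : List (α × β)) (a : α) => T.filterMap fun r =>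
      if r.1 = a then some r.2 else none :=
  listFilterMap fst (Primrec.ite (Primrec.eq.comp (fst.comp snd) (snd.comp fst))
    (option_some.comp (snd.comp snd)) (const none))

namespace Code

theorem primrec_size : Primrec size := succ.comp (snd.comp fst)

theorem primrec_start : Primrec start :=
  nat_mod.comp (fst.comp (fst.comp snd)) primrec_size

theorem primrec_accept : Primrec accept :=
  nat_mod.comp (fst.comp (snd.comp (fst.comp snd))) primrec_size

theorem primrec_query : Primrec query :=
  nat_mod.comp (fst.comp (snd.comp (snd.comp (fst.comp snd)))) primrec_size

theorem primrec_yes : Primrec yes :=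
  nat_mod.comp (fst.comp (snd.comp (snd.comp (snd.comp (fst.comp snd))))) primrec_size

theorem primrec_no : Primrec no :=
  nat_mod.comp (snd.comp (snd.comp (snd.comp (snd.comp (fst.comp snd))))) primrec_size

theorem primrec_transitions : Primrec fun c : Code => c.2.2 := snd.comp snd

theorem primrec_lookups (det : Bool) :
    Primrec₂ fun (c : Code) (p : ℕ × List (Option Bool)) => c.lookups det p.1 p.2 := by
  have h := primrec_filterMap_lookup (β := (ℕ × List (Option Bool × Option Bool) × Option Bool)).comp₂
    (primrec_transitions.comp₂ Primrec₂.left) (Primrec₂.right (α := Code))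
  cases det
  · exact list_take.comp₂ (list_length.comp₂ (primrec_transitions.comp₂ Primrec₂.left)) h
  · exact list_take.comp₂ (Primrec₂.const 1) h

theorem primrec_query_eq : PrimrecRel fun (c : Code) (l : LCfg) => l.1 % c.size = c.query :=
  Primrec.eq.comp (nat_mod.comp (fst.comp snd) (primrec_size.comp fst)) (primrec_query.comp fst)

theorem primrec_answer : Primrec₂ fun (p : Code × List Bool) (w : List Bool) =>
    if p.2.getD (strIndex w) false = true then p.1.yes else p.1.no :=
  Primrec.ite (Primrec.eq.comp ((list_getD false).comp (snd.comp fst) (primrec_strIndex.comp snd))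
    (const true)) (primrec_yes.comp (fst.comp fst)) (primrec_no.comp (fst.comp fst))

theorem primrec_scan : Primrec₂ fun (k : ℕ) (T : List (List (Option Bool) × List (Option Bool))) =>
    (List.range (k + 1)).map fun i => listHead (T.getD i default) :=
  list_map (list_range.comp (succ.comp fst))
    (list_headI.comp (snd.comp ((list_getD default).comp (snd.comp fst) snd)))

theorem primrec_mapUpdate : Primrec₂ fun (p : ℕ × List (List (Option Bool) × List (Option Bool)))
    (u : List (Option Bool × Option Bool)) => (List.range (p.1 + 1)).map fun i =>
      listUpdate (u.getD i default) (p.2.getD i default) :=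
  list_map (list_range.comp (succ.comp (fst.comp fst))) (primrec_listUpdate.comp
    ((list_getD default).comp (snd.comp fst) snd)
    ((list_getD default).comp (snd.comp (fst.comp fst)) snd))

theorem primrec_listAct : Primrec₂ fun (p : ℕ × LCfg)
    (u : ℕ × List (Option Bool × Option Bool) × Option Bool) =>
    ((u.1, (List.range (p.1 + 1)).map fun i =>
      listUpdate (u.2.1.getD i default) (p.2.2.1.getD i default), p.2.2.2 ++ u.2.2.toList) :
        LCfg) := by
  have h1 : Primrec fun p : ℕ × LCfg => (p.1, p.2.2.1) := pair fst (fst.comp (snd.comp snd))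
  have h2 : Primrec fun p : ℕ × LCfg => p.2.2.2 := snd.comp (snd.comp snd)
  have h3 : Primrec fun u : ℕ × List (Option Bool × Option Bool) × Option Bool => u.2.1 :=
    fst.comp snd
  have h4 : Primrec fun u : ℕ × List (Option Bool × Option Bool) × Option Bool => u.2.2.toList :=
    optionToList.comp (snd.comp snd)
  exact Primrec₂.pair.comp₂ (fst.comp₂ Primrec₂.right) (Primrec₂.pair.comp₂
    (primrec_mapUpdate.comp₂ (h1.comp₂ Primrec₂.left) (h3.comp₂ Primrec₂.right))
    (list_append.comp₂ (h2.comp₂ Primrec₂.left) (h4.comp₂ Primrec₂.right)))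

theorem primrec_k : Primrec k := fst.comp fst

theorem primrec_lookups_scan (det : Bool) : Primrec₂ fun (c : Code) (l : LCfg) =>
    c.lookups det (l.1 % c.size)
      ((List.range (c.k + 1)).map fun i => listHead (l.2.1.getD i default)) := by
  have h0 : Primrec₂ fun (c : Code) (_ : LCfg) => c := Primrec₂.left
  have h1 : Primrec₂ fun (c : Code) (l : LCfg) => l.1 % c.size :=
    nat_mod.comp (fst.comp snd) (primrec_size.comp fst)
  have h2 : Primrec fun l : LCfg => l.2.1 := fst.comp snd
  have h3 : Primrec₂ fun (c : Code) (l : LCfg) =>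
      (List.range (c.k + 1)).map fun i => listHead (l.2.1.getD i default) :=
    primrec_scan.comp₂ (primrec_k.comp₂ Primrec₂.left) (h2.comp₂ Primrec₂.right)
  have h4 := (primrec_lookups det).comp₂ h0 (Primrec₂.pair.comp₂ h1 h3)
  exact h4

theorem primrec_answerStep : Primrec₂ fun (p : Code × List Bool) (l : LCfg) =>
    [((if p.2.getD (strIndex l.2.2) false = true then p.1.yes else p.1.no, l.2.1, []) : LCfg)] := by
  have hw : Primrec fun l : LCfg => l.2.2 := snd.comp snd
  have hT : Primrec fun l : LCfg => l.2.1 := fst.comp snd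
  have h1 : Primrec₂ fun (p : Code × List Bool) (l : LCfg) =>
    if p.2.getD (strIndex l.2.2) false = true then p.1.yes else p.1.no := primrec_answer.comp₂ Primrec₂.left
      (hw.comp₂ Primrec₂.right)
  have h2 : Primrec₂ fun (_ : Code × List Bool) (l : LCfg) => (l.2.1, ([] : List Bool)) :=
    Primrec₂.pair.comp₂ (hT.comp₂ Primrec₂.right) (Primrec₂.const [])
  exact list_cons.comp₂ (Primrec₂.pair.comp₂ h1 h2) (Primrec₂.const [])

theorem primrec_actStep (det : Bool) : Primrec₂ fun (c : Code) (l : LCfg) =>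
    (c.lookups det (l.1 % c.size)
      ((List.range (c.k + 1)).map fun i => listHead (l.2.1.getD i default))).map fun u =>
      ((u.1, (List.range (c.k + 1)).map fun i =>
        listUpdate (u.2.1.getD i default) (l.2.1.getD i default), l.2.2 ++ u.2.2.toList) : LCfg) := by
  have h2 : Primrec fun p : Code × LCfg => p.1.lookups det (p.2.1 % p.1.size)
      ((List.range (p.1.k + 1)).map fun i => listHead (p.2.2.1.getD i default)) :=
    primrec_lookups_scan det
  have h3 : Primrec fun p : Code × LCfg => (p.1.k, p.2) := pair (primrec_k.comp fst) snd
  have h4 := primrec_listAct.comp₂ (h3.comp₂ Primrec₂.left) (Primrec₂.right)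
  have h5 := list_map h2 h4
  exact h5

theorem primrec_listStep (det : Bool) :
    Primrec₂ fun (p : Code × List Bool) (l : LCfg) => p.1.listStep det p.2 l := by
  have hc : Primrec₂ fun (p : Code × List Bool) (_ : LCfg) => p.1 := fst.comp₂ Primrec₂.left
  have hl : Primrec₂ fun (_ : Code × List Bool) (l : LCfg) => l := Primrec₂.right
  have h1 := primrec_query_eq.comp₂ hc hl
  have h2 := (primrec_actStep det).comp₂ hc hl
  have h3 := Primrec.ite h1 primrec_answerStep h2
  exact h3

theorem primrec_listInit : Primrec₂ fun (c : Code) (x : List Bool) =>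
    [((c.start, [([], x.map some)], []) : LCfg)] := by
  have h1 : Primrec fun x : List Bool =>
      ([([], x.map some)] : List (List (Option Bool) × List (Option Bool))) :=
    list_cons.comp (pair (const []) (list_map Primrec.id (option_some.comp snd))) (const [])
  have h2 : Primrec fun x : List Bool =>
      (([([], x.map some)], []) : List (List (Option Bool) × List (Option Bool)) × List Bool) :=
    h1.pair (const [])
  exact list_cons.comp₂ (Primrec₂.pair.comp₂ (primrec_start.comp₂ Primrec₂.left)
    (h2.comp₂ Primrec₂.right)) (Primrec₂.const [])

theorem primrec_flatMap_listStep (det : Bool) :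
    Primrec₂ fun (p : Code × List Bool) (ls : List LCfg) => ls.flatMap (p.1.listStep det p.2) := by
  have h : Primrec₂ fun (q : (Code × List Bool) × List LCfg) (l : LCfg) =>
    q.1.1.listStep det q.1.2 l :=
    (primrec_listStep det).comp₂ (fst.comp₂ Primrec₂.left) Primrec₂.right
  exact list_flatMap snd h

/-- The full list of configurations at each time is carried along by recursion on `n`, so
nondeterminism is handled without any search. -/
theorem primrec_listAfter (det : Bool) :
    Primrec₂ fun (p : (Code × List Bool) × List Bool) (n : ℕ) =>
      p.1.1.listAfter det p.1.2 p.2 n := by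
  have h1 : Primrec fun p : (Code × List Bool) × List Bool =>
      [((p.1.1.start, [([], p.2.map some)], []) : LCfg)] :=
    primrec_listInit.comp (fst.comp fst) snd
  have h2 : Primrec₂ fun (p : (Code × List Bool) × List Bool) (q : ℕ × List LCfg) =>
      q.2.flatMap (p.1.1.listStep det p.1.2) :=
    (primrec_flatMap_listStep det).comp (fst.comp fst) (snd.comp snd)
  have h3 := nat_rec h1 h2
  exact h3

theorem primrec_listHalts (det : Bool) :
    PrimrecRel fun (p : (Code × List Bool) × List Bool) (t : ℕ) =>
      p.1.1.ListHalts det p.1.2 p.2 t :=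
  Primrec.eq.comp₂ ((primrec_listAfter det).comp₂ Primrec₂.left (succ.comp₂ Primrec₂.right))
    (Primrec₂.const [])

theorem primrec_listAccepts (det : Bool) :
    PrimrecRel fun (p : (Code × List Bool) × List Bool) (t : ℕ) =>
      p.1.1.ListAccepts det p.1.2 p.2 t := by
  have h1 : PrimrecRel fun (l : LCfg) (p : Code × List Bool) => p.1.listStep det p.2 l = [] :=
    Primrec.eq.comp₂ ((primrec_listStep det).comp₂ Primrec₂.right Primrec₂.left)
      (Primrec₂.const [])
  have h2 : PrimrecRel fun (l : LCfg) (c : Code) => l.1 % c.size = c.accept :=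
    Primrec.eq.comp (nat_mod.comp (fst.comp fst) (primrec_size.comp snd)) (primrec_accept.comp snd)
  have h3 : PrimrecRel fun (l : LCfg) (p : Code × List Bool) =>
      p.1.listStep det p.2 l = [] ∧ l.1 % p.1.size = p.1.accept :=
    PrimrecPred.and h1 (h2.comp₂ Primrec₂.left (fst.comp₂ Primrec₂.right))
  have h4 : Primrec₂ fun (p : (Code × List Bool) × List Bool) (t : ℕ) =>
      (List.range (t + 1)).flatMap (p.1.1.listAfter det p.1.2 p.2) := by
    have h : Primrec₂ fun (q : ((Code × List Bool) × List Bool) × ℕ) (n : ℕ) =>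
        q.1.1.1.listAfter det q.1.1.2 q.1.2 n :=
      (primrec_listAfter det).comp₂ (fst.comp₂ Primrec₂.left) Primrec₂.right
    exact list_flatMap (list_range.comp (succ.comp snd)) h
  have h5 := h3.exists_mem_list.comp₂ h4 (fst.comp₂ Primrec₂.left)
  exact h5

end Code
-- Lightface form of the two sets
/-- With the oracle that is given by `σ`, the machine coded by `c` does not halt on input `x` within
`|x| ^ d + d` steps, or it does not answer as the machine coded by `c₀` (if `flip` is false), or it
does answer so (if `flip` is true); moreover `σ` is long enough to see this. -/
def Refutes (det flip : Bool) (c₀ : Code) (d₀ : ℕ) (p : Code × ℕ) (σ x : List Bool) : Prop :=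
  2 ^ ((x.length ^ p.2 + p.2) + (x.length ^ d₀ + d₀) + 1) ≤ σ.length ∧
    ¬(p.1.ListHalts det σ x (x.length ^ p.2 + p.2) ∧
      ((p.1.ListAccepts det σ x (x.length ^ p.2 + p.2) ↔
        c₀.ListAccepts false σ x (x.length ^ d₀ + d₀)) ↔ flip = false))

/-- The length requirement makes the verdict obtained from the segment the verdict for `oracle f`.
Acceptance may be replaced by acceptance within the time bound: for `c₀` by `h₀`, and for the other
machine because answers are compared only if it halts in time. -/
theorem refutes_iff {det flip : Bool} {c₀ : Code} {d₀ : ℕ}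
    (h₀ : ∀ A, (c₀.machine false).PolyTime A d₀) (p : Code × ℕ) (f : ℕ → Bool) (m : ℕ)
    (x : List Bool) : Refutes det flip c₀ d₀ p ((List.range m).map f) x ↔
      2 ^ ((x.length ^ p.2 + p.2) + (x.length ^ d₀ + d₀) + 1) ≤ m ∧
        ¬((p.1.machine det).HaltsWithin (oracle f) x (x.length ^ p.2 + p.2) ∧
          (((p.1.machine det).Accepts (oracle f) x ↔ (c₀.machine false).Accepts (oracle f) x) ↔
            flip = false)) := by
  rw [Refutes, List.length_map, List.length_range]
  refine and_congr_right fun hm => not_congr ?_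
  have h1 : 2 ^ ((x.length ^ p.2 + p.2) + 1) ≤ m :=
    (Nat.pow_le_pow_right two_pos (by omega)).trans hm
  have h2 : 2 ^ ((x.length ^ d₀ + d₀) + 1) ≤ m :=
    (Nat.pow_le_pow_right two_pos (by omega)).trans hm
  rw [Code.listHalts_iff, OracleNTM.haltsWithin_congr (mem_listOracle h1)]
  refine and_congr_right fun h => ?_
  rw [Code.listAccepts_iff, Code.listAccepts_iff,
    OracleNTM.acceptsWithin_congr (mem_listOracle h1),
    OracleNTM.acceptsWithin_congr (mem_listOracle h2), h.accepts_iff, (h₀ _ x).accepts_iff]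

theorem _root_.PrimrecPred.iff {α : Type*} [Primcodable α] {p q : α → Prop} (hp : PrimrecPred p)
    (hq : PrimrecPred q) : PrimrecPred fun a => p a ↔ q a :=
  ((hp.and hq).or (hp.not.and hq.not)).of_eq fun _ => iff_iff_and_or_not_and_not.symm

theorem primrec_timeBound : Primrec₂ fun (d : ℕ) (x : List Bool) => x.length ^ d + d :=
  nat_add.comp (nat_pow.comp (list_length.comp snd) fst) fst

theorem primrec_refutes (det flip : Bool) (c₀ : Code) (d₀ : ℕ) :
    PrimrecPred fun q : (Code × ℕ) × List Bool × List Bool =>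
      Refutes det flip c₀ d₀ q.1 q.2.1 q.2.2 := by
  have ht : Primrec fun q : (Code × ℕ) × List Bool × List Bool =>
      q.2.2.length ^ q.1.2 + q.1.2 := primrec_timeBound.comp (snd.comp fst) (snd.comp snd)
  have ht₀ : Primrec fun q : (Code × ℕ) × List Bool × List Bool =>
      q.2.2.length ^ d₀ + d₀ := primrec_timeBound.comp (const d₀) (snd.comp snd)
  have hp : Primrec fun q : (Code × ℕ) × List Bool × List Bool => ((q.1.1, q.2.1), q.2.2) :=
    pair (pair (fst.comp fst) (fst.comp snd)) (snd.comp snd)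
  have hp₀ : Primrec fun q : (Code × ℕ) × List Bool × List Bool => ((c₀, q.2.1), q.2.2) :=
    pair (pair (const c₀) (fst.comp snd)) (snd.comp snd)
  have h1 := nat_le.comp (nat_pow.comp (const 2) (succ.comp (nat_add.comp ht ht₀)))
    (list_length.comp (fst.comp (snd (α := Code × ℕ) (β := List Bool × List Bool))))
  have h2 := (Code.primrec_listHalts det).comp hp ht
  have h3 := (Code.primrec_listAccepts det).comp hp ht
  have h4 := (Code.primrec_listAccepts false).comp hp₀ ht₀
  have h5 := Primrec.eq.comp (const (α := (Code × ℕ) × List Bool × List Bool) flip) (const false)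
  have h6 := h1.and (h2.and ((h3.iff h4).iff h5)).not
  exact h6

/-- The coded machine and time bound with number `n`. -/
def codeWithBound (n : ℕ) : Code × ℕ := (Encodable.decode n).getD default

/-- The input with number `n`. -/
def inputOf (n : ℕ) : List Bool := (Encodable.decode n).getD default

theorem primrec_codeWithBound : Primrec codeWithBound := option_getD_default.comp Primrec.decode

theorem primrec_inputOf : Primrec inputOf := option_getD_default.comp Primrec.decode

/-- The pairs `(n, σ)` such that `Refutes` holds for the `n`-th coded machine with a time bound, the
segment `σ`, and some input whose number is less than the length of `σ`. -/
def Separates (det flip : Bool) (c₀ : Code) (d₀ : ℕ) (p : ℕ × List Bool) : Prop :=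
  ∃ j ∈ List.range p.2.length, Refutes det flip c₀ d₀ (codeWithBound p.1) p.2 (inputOf j)

theorem primrec_exists_lt_length {α β : Type*} [Primcodable α] [Primcodable β]
    {R : α → List Bool → β → Prop} (hR : PrimrecPred fun q : α × List Bool × β => R q.1 q.2.1 q.2.2)
    {f : ℕ → α} (hf : Primrec f) {g : ℕ → β} (hg : Primrec g) :
    PrimrecPred fun p : ℕ × List Bool => ∃ j ∈ List.range p.2.length, R (f p.1) p.2 (g j) := by
  have h : PrimrecRel fun (j : ℕ) (p : ℕ × List Bool) => R (f p.1) p.2 (g j) :=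
    hR.comp (pair (hf.comp (fst.comp snd)) (pair (snd.comp snd) (hg.comp fst)))
  exact h.exists_mem_list.comp (list_range.comp (list_length.comp snd)) Primrec.id

theorem primrec_separates (det flip : Bool) (c₀ : Code) (d₀ : ℕ) :
    PrimrecPred (Separates det flip c₀ d₀) :=
  primrec_exists_lt_length (primrec_refutes det flip c₀ d₀) primrec_codeWithBound primrec_inputOf

theorem exists_separates_iff {det flip : Bool} {c₀ : Code} {d₀ : ℕ}
    (h₀ : ∀ A, (c₀.machine false).PolyTime A d₀) (n : ℕ) (f : ℕ → Bool) :
    (∃ m, Separates det flip c₀ d₀ (n, (List.range m).map f)) ↔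
      ¬(((codeWithBound n).1.machine det).PolyTime (oracle f) (codeWithBound n).2 ∧
        ∀ x, ((((codeWithBound n).1.machine det).Accepts (oracle f) x ↔
          (c₀.machine false).Accepts (oracle f) x) ↔ flip = false)) := by
  rw [OracleNTM.PolyTime, ← forall_and, not_forall]
  simp only [Separates, refutes_iff h₀, List.mem_range, List.length_map, List.length_range]
  constructor
  · rintro ⟨m, j, -, -, h⟩
    exact ⟨_, h⟩
  · rintro ⟨x, hx⟩
    -- The segment must exceed the number of `x`, to bring `x` into the bounded search, and must
    -- cover the questions of both machines.
    refine ⟨max (Encodable.encode x + 1)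
      (2 ^ ((x.length ^ (codeWithBound n).2 + (codeWithBound n).2) + (x.length ^ d₀ + d₀) + 1)),
      Encodable.encode x, by simp, ?_⟩
    have hinput : inputOf (Encodable.encode x) = x := by simp [inputOf]
    rw [hinput]
    exact ⟨le_max_right _ _, hx⟩

/-- The set of oracles for which no polynomial-time machine (and no deterministic one, if `det` is
true) accepts the language of `U` (or the complement of that language, if `flip` is true). -/
theorem lightfacePi02_not_exists (det flip : Bool) (U : OracleNTM) (d : ℕ)
    (hU : ∀ A, U.PolyTime A d) : LightfacePi02 {f | ¬∃ M : OracleNTM,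
      (det = true → M.Deterministic) ∧ (∃ d, M.PolyTime (oracle f) d) ∧
        ∀ x, (M.Accepts (oracle f) x ↔ U.Accepts (oracle f) x) ↔ flip = false} := by
  obtain ⟨c₀, hc₀⟩ := exists_code U false (by simp)
  have h₀ : ∀ A, (c₀.machine false).PolyTime A d := fun A => ((hc₀ A).2 d).2 (hU A)
  refine ⟨_, ⟨Separates det flip c₀ d, (primrec_separates det flip c₀ d).computablePred.to_re,
    fun _ _ => Iff.rfl⟩, ?_⟩
  ext f
  have hlang : ∀ x, U.Accepts (oracle f) x ↔ (c₀.machine false).Accepts (oracle f) x := fun x =>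
    Set.ext_iff.1 (hc₀ _).1.symm x
  simp only [Set.mem_ofPred_eq, exists_separates_iff h₀, hlang]
  constructor
  -- A code that is not refuted is itself a machine of the excluded kind.
  · intro h n hn
    refine h ⟨_, ?_, ⟨_, hn.1⟩, hn.2⟩
    rintro rfl
    exact Code.machine_deterministic _
  · rintro h ⟨M, hM, ⟨e, he⟩, hx⟩
    obtain ⟨c, hc⟩ := exists_code M det hM
    -- The enumeration runs through all pairs of a code and an exponent, so it contains the given
    -- machine with its own time bound.
    have hcode : codeWithBound (Encodable.encode (c, e)) = (c, e) := by simp [codeWithBound]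
    refine h (Encodable.encode (c, e)) ?_
    rw [hcode]
    refine ⟨((hc _).2 e).2 he, fun x => ?_⟩
    have hacc : (c.machine det).Accepts (oracle f) x ↔ M.Accepts (oracle f) x :=
      Set.ext_iff.1 (hc _).1 x
    rw [hacc]
    exact hx x

theorem lightfacePi02_sepPNP : LightfacePi02 sepPNP := by
  obtain ⟨d, hd⟩ := evaluator_polyTime
  convert lightfacePi02_not_exists true false evaluator d hd using 1
  ext f
  refine not_congr ((evaluator_mem_P_iff _).symm.trans (exists_congr fun M => ?_))
  simp [Set.ext_iff, OracleNTM.language]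

theorem lightfacePi02_sepNPcoNP : LightfacePi02 sepNPcoNP := by
  obtain ⟨d, hd⟩ := evaluator_polyTime
  convert lightfacePi02_not_exists false true evaluator d hd using 1
  ext f
  refine not_congr ((evaluator_compl_mem_NP_iff _).symm.trans (exists_congr fun M => ?_))
  -- With `flip` true the condition says that the two machines disagree on every input, so that one
  -- accepts the complement of the other's language.
  simp only [Set.ext_iff, OracleNTM.language, Set.mem_compl_iff, Set.mem_ofPred_eq,
    Bool.false_eq_true, Bool.true_eq_false, false_imp_iff, true_and, iff_false, ← xor_iff_iff_not,
    xor_iff_not_iff]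

/-! ### Borel measurability and the theorem -/

theorem isOpen_exists_initialSegment (W : List Bool → Prop) :
    IsOpen {f : ℕ → Bool | ∃ m, W ((List.range m).map f)} := by
  simp only [Set.ofPred_exists]
  refine isOpen_iUnion fun m => ?_
  -- For fixed `m` the condition is a preimage under restriction to `m` coordinates, whose target is
  -- discrete.
  have h : Continuous fun (f : ℕ → Bool) (i : Fin m) => f i :=
    continuous_pi fun i => continuous_apply _
  convert (isOpen_discrete {g : Fin m → Bool | W (List.ofFn g)}).preimage h using 1
  ext f
  have : (List.range m).map f = List.ofFn fun i : Fin m => f i :=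
    List.ext_getElem (by simp) (by simp)
  simp [this]

theorem LightfacePi02.measurableSet {S : Set (ℕ → Bool)} (h : LightfacePi02 S) :
    @MeasurableSet (ℕ → Bool) (borel (ℕ → Bool)) S := by
  obtain ⟨R, ⟨W, -, hW⟩, rfl⟩ := h
  simp only [hW, Set.ofPred_forall]
  let : MeasurableSpace (ℕ → Bool) := borel _
  have : BorelSpace (ℕ → Bool) := ⟨rfl⟩
  exact MeasurableSet.iInter fun n =>
    (isOpen_exists_initialSegment fun σ => W (n, σ)).measurableSet

end RelComplexity

theorem mainTheorem7 :
    (RelComplexity.LightfacePi02 RelComplexity.sepPNP ∧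
      @MeasurableSet (ℕ → Bool) (borel (ℕ → Bool)) RelComplexity.sepPNP) ∧
    (RelComplexity.LightfacePi02 RelComplexity.sepNPcoNP ∧
      @MeasurableSet (ℕ → Bool) (borel (ℕ → Bool)) RelComplexity.sepNPcoNP) ∧
    ∃ (U : RelComplexity.OracleNTM) (d : ℕ), ∀ A : Set (List Bool), U.PolyTime A d ∧
      (U.language A ∈ RelComplexity.P A ↔ RelComplexity.P A = RelComplexity.NP A) := by
  refine ⟨⟨RelComplexity.lightfacePi02_sepPNP, RelComplexity.lightfacePi02_sepPNP.measurableSet⟩,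
    ⟨RelComplexity.lightfacePi02_sepNPcoNP, RelComplexity.lightfacePi02_sepNPcoNP.measurableSet⟩,
    ?_⟩
  obtain ⟨d, hd⟩ := RelComplexity.evaluator_polyTime
  exact ⟨RelComplexity.evaluator, d, fun A => ⟨hd A, RelComplexity.evaluator_mem_P_iff A⟩⟩
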